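/- A group is virtually cyclic if it has a cyclic subgroup of finite index (so finite groups are included). For a finitely generated group $G$ and a subset $Z\subseteq G$, the relative rank $\operatorname{rk}_Z(G)$ is the smallest cardinality of a subset $S\subseteq G$ such that $G=\langle S\cup Z\rangle$. Two $n$-tuples of elements of $G$ are Nielsen-equivalent in $G$ if one can be transformed into the other by a finite chain of the following moves: replace an entry $g_i$ by $g_i^{-1}$; replace $g_i$ by $g_ig_j$ for some $j\neq i$; interchange $g_i$ and $g_j$ for some $i\ne j$. (1) There is an algorithm that, given any finite presentation $\langle x_1,\dots,x_n\mid R\rangle$ of a virtually cyclic group $G$ and a finite subset $Z\subseteq G$ (given as a finite list of words in the generators and their inverses), terminates and outputs $\operatorname{rk}_Z(G)$. (2) Let $G$ be a virtually cyclic group and let $Z=(z_1,\dots,z_m)$ be a tuple of elements of $G$ generating a finite subgroup of $G$. Then for every $k\ge 1$ there is a finite set $E$ of tuples of the form $(f_1,\dots,f_k,z_1,\dots,z_m)$ with $f_i\in G$ such that every tuple $(g_1,\dots,g_k,z_1,\dots,z_m)$ generating $G$ is Nielsen-equivalent in $G$ to a tuple from $E$. -/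

import Mathlib

namespace VCRank

/-- A group is virtually cyclic if it has a cyclic subgroup of finite index. In particular every
finite group is virtually cyclic. -/
def IsVirtuallyCyclic (G : Type*) [Group G] : Prop :=
  ∃ C : Subgroup G, IsCyclic C ∧ C.FiniteIndex

/-- The relative rank of `G` with respect to `Z`: the smallest cardinality of a subset `S` of `G`
such that `S ∪ Z` generates `G`. The infimum is attained, since `ℕ∞` is well ordered and `S` can
always be taken to be all of `G`; it is finite when `G` is finitely generated. -/
noncomputable def relRank {G : Type*} [Group G] (Z : Set G) : ℕ∞ :=
  ⨅ S ∈ {S : Set G | Subgroup.closure (S ∪ Z) = ⊤}, S.encard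

/-- Group words in the letters `x₀, …, xₙ₋₁`: the letter `(i, true)` stands for `xᵢ` and
`(i, false)` for `xᵢ⁻¹`. -/
abbrev Word (n : ℕ) : Type := List (Fin n × Bool)

/-- The group `⟨x₀, …, xₙ₋₁ | R⟩` given by a finite presentation. -/
abbrev FinPresGroup (n : ℕ) (R : List (Word n)) : Type :=
  PresentedGroup (FreeGroup.mk '' {w : Word n | w ∈ R})

/-- The element of `⟨x₀, …, xₙ₋₁ | R⟩` represented by a word. -/
def wordElt {n : ℕ} (R : List (Word n)) (w : Word n) : FinPresGroup n R :=
  PresentedGroup.mk _ (FreeGroup.mk w)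

/-- The finite subset of `⟨x₀, …, xₙ₋₁ | R⟩` represented by a finite list of words. -/
def wordSet {n : ℕ} (R Z : List (Word n)) : Set (FinPresGroup n R) :=
  wordElt R '' {w : Word n | w ∈ Z}

/-- A finite list of words as input data of an algorithm: every letter is replaced by its number
and its sign. -/
def codeWords {n : ℕ} (L : List (Word n)) : List (List (ℕ × Bool)) :=
  L.map (fun w => w.map (fun a => ((a.1 : ℕ), a.2)))

/-- The elementary Nielsen moves on `n`-tuples of elements of a group. -/
inductive NielsenMove {G : Type*} [Group G] {n : ℕ} : (Fin n → G) → (Fin n → G) → Prop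
  | inv (t : Fin n → G) (i : Fin n) : NielsenMove t (Function.update t i (t i)⁻¹)
  | mul (t : Fin n → G) (i j : Fin n) (hij : i ≠ j) :
      NielsenMove t (Function.update t i (t i * t j))
  | swap (t : Fin n → G) (i j : Fin n) (hij : i ≠ j) : NielsenMove t (t ∘ Equiv.swap i j)

/-- Nielsen equivalence: a finite chain of elementary Nielsen moves transforms `t` to `t'`. -/
def NielsenEquiv {G : Type*} [Group G] {n : ℕ} (t t' : Fin n → G) : Prop :=
  Relation.ReflTransGen NielsenMove t t'

end VCRank

/-! ### Actions on a line: crossed homomorphisms to the integers -/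

namespace VCRank

open Subgroup

variable {G : Type*} [Group G]

/-! For finite `G` the second claim is trivial, so let `G` be infinite. Then `G` acts on the line by
`n ↦ b g + ε g * n`: `ε g` says whether `g` is a translation or a reflection, and `b g` is the
displacement of the origin. The element `t` translates by `b t > 0`, and only finitely many elements
have bounded displacement. If `Z` generates a finite subgroup, the origin can be moved so that `b`
vanishes on it (`Axis.exists_vanishing`).

Finiteness of the Nielsen classes is Euclid's algorithm on displacements. In a tuple minimising
first the number of reflections and then the total displacement, at most one entry is a reflection,
at most one translation has a nonzero displacement `x`, and every other displacement is at most
`|x|` in absolute value (`Axis.exists_normalForm`). Recentred at the reflection, every entry has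
displacement divisible by `x`; if the tuple generates `G` together with `Z`, then `x` divides `b t`,
which leaves finitely many tuples.

For the algorithm, upper bounds on the relative rank are witnessed by derivations of the letters.
Lower bounds are witnessed by finite quotients (`exists_normal_finiteIndex`). If `Z` generates an
infinite subgroup, this subgroup has finite index and its normal core serves. Otherwise the quotient
by a power of `t` serves: a tuple generating modulo this power is brought to normal form and its
translation is corrected so that it generates `G` itself (`Axis.exists_generating`). Both kinds of
witness form one certificate with a primitive recursive check, so an unbounded search finds the
rank. -/

/-- A crossed homomorphism to `ℤ`, twisted by the sign character `ε`, together with an element `t`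
generating a normal subgroup of finite index, on which it does not vanish. -/
structure Axis (G : Type*) [Group G] where
  t : G
  ε : G →* ℤˣ
  b : G → ℤ
  conj : ∀ g, g * t * g⁻¹ = t ^ (ε g : ℤ)
  b_mul : ∀ g h, b (g * h) = b g + ε g * b h
  b_pos : 0 < b t
  ε_t : ε t = 1
  finiteIndex : (zpowers t).FiniteIndex

namespace Axis

variable (A : Axis G)

lemma b_one : A.b 1 = 0 := by
  have := A.b_mul 1 1
  simp at this
  exact this

lemma b_inv (g : G) : A.b g⁻¹ = -(A.ε g * A.b g) := by
  have h := A.b_mul g g⁻¹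
  rw [mul_inv_cancel, A.b_one] at h
  rcases Int.units_eq_one_or (A.ε g) with h1 | h1 <;> rw [h1] at h ⊢ <;> simp at h ⊢ <;> omega

lemma b_pow {g : G} (hg : A.ε g = 1) (n : ℕ) : A.b (g ^ n) = n * A.b g := by
  induction n with
  | zero => simp [A.b_one]
  | succ n ih => rw [pow_succ, A.b_mul, ih, map_pow, hg]; push_cast; simp; ring

lemma b_zpow {g : G} (hg : A.ε g = 1) (n : ℤ) : A.b (g ^ n) = n * A.b g := by
  cases n with
  | ofNat n => simpa using A.b_pow hg n
  | negSucc n =>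
    rw [zpow_negSucc, A.b_inv, A.b_pow hg, map_pow, hg]
    push_cast
    simp [Int.negSucc_eq]
    ring

lemma b_mul_zpow (g : G) (c : ℤ) : A.b (g * A.t ^ c) = A.b g + A.ε g * (c * A.b A.t) := by
  rw [A.b_mul, A.b_zpow A.ε_t]

lemma conj_zpow (g : G) (c : ℤ) : g * A.t ^ c * g⁻¹ = A.t ^ (A.ε g * c) := by
  rw [← _root_.conj_zpow, A.conj, zpow_mul]

instance normal_zpowers (c : ℤ) : (zpowers (A.t ^ c)).Normal := by
  constructor
  rintro _ ⟨k, rfl⟩ g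
  refine ⟨A.ε g * k, ?_⟩
  simp only
  rw [← zpow_mul, ← zpow_mul, A.conj_zpow]
  congr 1; ring

/-- On each of the finitely many cosets of `⟨t⟩` the function `b` is injective, because `b t ≠ 0`.
-/
lemma finite_fiber (v : ℤ) : {g | A.b g = v}.Finite := by
  have := A.finiteIndex
  refine Set.Finite.of_injOn (f := fun g : G => (g : G ⧸ zpowers A.t)) (t := Set.univ)
    (fun _ _ => Set.mem_univ _) ?_ Set.finite_univ
  intro g hg h hh hgh
  obtain ⟨c, hc⟩ : g⁻¹ * h ∈ zpowers A.t := QuotientGroup.eq.1 hgh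
  have hc' : h = g * A.t ^ c := by
    simp only at hc
    rw [hc]; group
  have h1 := A.b_mul_zpow g c
  rw [← hc', show A.b h = v from hh, show A.b g = v from hg] at h1
  have h2 : (A.ε g : ℤ) * (c * A.b A.t) = 0 := by omega
  have h3 : c = 0 := by
    have := A.b_pos.ne'
    simpa [this] using h2
  rw [hc', h3]; simp

lemma finite_bounded (B : ℤ) : {g | |A.b g| ≤ B}.Finite := by
  refine ((Set.finite_Icc (-B) B).biUnion fun v _ => A.finite_fiber v).subset ?_
  intro g hg
  simp only [Set.mem_iUnion]
  exact ⟨A.b g, abs_le.1 hg, rfl⟩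

/-- Modification of the crossed homomorphism by a principal one. -/
def shift (w : ℤ) : Axis G where
  t := A.t
  ε := A.ε
  b g := 2 * A.b g + (A.ε g - 1) * w
  conj := A.conj
  b_mul g h := by rw [A.b_mul, map_mul]; push_cast; ring
  b_pos := by have := A.b_pos; rw [A.ε_t]; simpa using this
  ε_t := A.ε_t
  finiteIndex := A.finiteIndex

/-- The elements at which the crossed homomorphism is divisible by `x`. -/
def divSubgroup (x : ℤ) : Subgroup G where
  carrier := {g | x ∣ A.b g}
  mul_mem' {g h} hg hh := by
    simp only [Set.mem_ofPred_eq] at *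
    rw [A.b_mul]; exact dvd_add hg (hh.mul_left _)
  one_mem' := by simp [A.b_one]
  inv_mem' {g} hg := by
    simp only [Set.mem_ofPred_eq] at *
    rw [A.b_inv]; exact (hg.mul_left _).neg_right

lemma mem_divSubgroup {x : ℤ} {g : G} : g ∈ A.divSubgroup x ↔ x ∣ A.b g := Iff.rfl

lemma b_eq_zero_of_isOfFinOrder {g : G} (hg : A.ε g = 1) (h : IsOfFinOrder g) : A.b g = 0 := by
  obtain ⟨n, hn, h⟩ := isOfFinOrder_iff_pow_eq_one.1 h
  have := A.b_pow hg n
  rw [h, A.b_one] at this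
  simpa [hn.ne'] using this.symm

/-- After a shift, the crossed homomorphism vanishes on a given finite subgroup. -/
lemma exists_vanishing (H : Subgroup G) [Finite H] :
    ∃ B : Axis G, B.t = A.t ∧ ∀ h ∈ H, B.b h = 0 := by
  have fin : ∀ h ∈ H, IsOfFinOrder h := fun h hh =>
    Submonoid.isOfFinOrder_coe.2 (isOfFinOrder_of_finite (⟨h, hh⟩ : H))
  by_cases hε : ∀ h ∈ H, A.ε h = 1
  · exact ⟨A, rfl, fun h hh => A.b_eq_zero_of_isOfFinOrder (hε h hh) (fin h hh)⟩
  · push Not at hε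
    obtain ⟨z, hz, hzε⟩ := hε
    have hzε : A.ε z = -1 := (Int.units_eq_one_or _).resolve_left hzε
    -- The reflection `z` fixes the point `b z / 2`, which becomes the new origin; the doubling in
    -- `shift` keeps the values integral.
    refine ⟨A.shift (A.b z), rfl, fun h hh => ?_⟩
    simp only [shift]
    rcases Int.units_eq_one_or (A.ε h) with h1 | h1
    · rw [A.b_eq_zero_of_isOfFinOrder h1 (fin h hh), h1]; simp
    · have h2 := A.b_eq_zero_of_isOfFinOrder (g := z * h) (by rw [map_mul, hzε, h1]; rfl)
        (fin _ (H.mul_mem hz hh))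
      rw [A.b_mul, hzε] at h2
      rw [h1]
      push_cast at h2 ⊢
      linarith

end Axis

/-! ### Existence of the action on a line -/

lemma exists_normal_zpowers [Infinite G] (hG : IsVirtuallyCyclic G) :
    ∃ t : G, (zpowers t).Normal ∧ (zpowers t).FiniteIndex := by
  obtain ⟨C, hC, hi⟩ := hG
  obtain ⟨t, ht⟩ := (Subgroup.isCyclic_iff_exists_zpowers_eq_top C.normalCore).1
    (isCyclic_of_injective (Subgroup.inclusion C.normalCore_le)
      (Subgroup.inclusion_injective C.normalCore_le))
  exact ⟨t, ht ▸ inferInstance, ht ▸ inferInstance⟩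

/-- Every infinite virtually cyclic group acts on a line. -/
lemma exists_axis [Infinite G] (hG : IsVirtuallyCyclic G) : Nonempty (Axis G) := by
  classical
  obtain ⟨t, hn, hi⟩ := exists_normal_zpowers hG
  have hinf : ¬ IsOfFinOrder t := by
    intro h
    have : Finite (zpowers t) := h.finite_zpowers
    exact not_finite_iff_infinite.2 ‹Infinite G› (Finite.of_subgroup_quotient (zpowers t))
  have hinj : Function.Injective fun n : ℤ => t ^ n := injective_zpow_iff_not_isOfFinOrder.2 hinf
  have hex : ∀ g, ∃ a : ℤ, t ^ a = g * t * g⁻¹ := fun g => hn.conj_mem t (mem_zpowers t) g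
  choose a ha using hex
  -- Conjugation on `⟨t⟩ ≅ ℤ` gives exponents that multiply; as `G` is a group they are units, which
  -- yields the sign character.
  let e : G →* ℤ :=
    { toFun := a
      map_one' := hinj (by simp [ha])
      map_mul' := fun g h => hinj (by
        simp only
        rw [ha, zpow_mul, ha, conj_zpow, ha]
        group) }
  have hconj : ∀ g (c : ℤ), g * t ^ c = t ^ ((e.toHomUnits g : ℤ) * c) * g := by
    intro g c
    rw [MonoidHom.coe_toHomUnits, zpow_mul]
    change _ = (t ^ a g) ^ c * g
    rw [ha, conj_zpow]; group
  have hβ : ∀ (g : G) (q : G ⧸ zpowers t), ∃ β : ℤ, g * q.out = t ^ β * (g • q).out := by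
    intro g q
    have h1 : (((g • q).out : G) : G ⧸ zpowers t) = ((g * q.out : G) : G ⧸ zpowers t) := by
      rw [QuotientGroup.out_eq']
      conv_lhs => rw [← QuotientGroup.out_eq' q]
      rfl
    obtain ⟨β, h2⟩ := hn.mem_comm (QuotientGroup.eq.1 h1)
    refine ⟨β, ?_⟩
    simp only at h2
    rw [h2]; group
  choose β hβ using hβ
  have : Fintype (G ⧸ zpowers t) := Fintype.ofFinite _
  have hβmul : ∀ g h q, β (g * h) q = β g (h • q) + e.toHomUnits g * β h q := by
    intro g h q
    refine hinj ?_
    have h1 : t ^ β (g * h) q * ((g * h) • q).out =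
        t ^ (β g (h • q) + e.toHomUnits g * β h q) * ((g * h) • q).out := by
      rw [← hβ, mul_assoc, hβ h q, ← mul_assoc, hconj, mul_assoc, hβ, ← mul_assoc, ← zpow_add,
        mul_smul, add_comm]
    exact mul_right_cancel h1
  have hβt : ∀ q, β t q = 1 := by
    intro q
    refine hinj ?_
    have h1 : t • q = q := by
      conv_lhs => rw [← QuotientGroup.out_eq' q]
      conv_rhs => rw [← QuotientGroup.out_eq' q]
      refine QuotientGroup.eq.2 (hn.mem_comm ⟨-1, ?_⟩)
      simp
    have h2 := hβ t q
    rw [h1] at h2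
    simpa using (mul_right_cancel h2).symm
  -- As in the transfer, `β` is a cocycle depending on a coset, and summing over all cosets removes
  -- this dependence. Since `β t q = 1`, the value at `t` is the index of `⟨t⟩`.
  refine ⟨⟨t, e.toHomUnits, fun g => ∑ q, β g q, ?_, ?_, ?_, ?_, hi⟩⟩
  · intro g
    have := hconj g 1
    simp only [zpow_one, mul_one] at this
    rw [this]; group
  · intro g h
    simp only [hβmul, Finset.sum_add_distrib, ← Finset.mul_sum]
    congr 1
    exact Fintype.sum_bijective (fun q => h • q) (MulAction.bijective h) _ _ fun q => rfl
  · simp only [hβt]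
    simp [Fintype.card_pos]
  · have := hconj t 1
    refine Units.ext (hinj ?_)
    simp only [zpow_one, mul_one] at this
    have := mul_right_cancel this
    simpa using this.symm


/-! ### Nielsen moves relative to a fixed tuple -/

lemma NielsenMove.closure_range_eq {n : ℕ} {t t' : Fin n → G} (h : NielsenMove t t') :
    closure (Set.range t) = closure (Set.range t') := by
  have mem : ∀ (s : Fin n → G) i, s i ∈ closure (Set.range s) :=
    fun s i => subset_closure ⟨i, rfl⟩
  cases h with
  | inv i =>
    apply le_antisymm <;> rw [closure_le] <;> rintro _ ⟨l, rfl⟩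
    · by_cases hl : l = i
      · subst hl
        have := inv_mem (mem (Function.update t l (t l)⁻¹) l)
        simpa using this
      · have := mem (Function.update t i (t i)⁻¹) l
        rwa [Function.update_of_ne hl] at this
    · by_cases hl : l = i
      · subst hl
        simpa using mem t l
      · rw [Function.update_of_ne hl]
        exact mem t l
  | mul i j hij =>
    apply le_antisymm <;> rw [closure_le] <;> rintro _ ⟨l, rfl⟩
    · by_cases hl : l = i
      · subst hl
        have := mul_mem (mem (Function.update t l (t l * t j)) l)
          (inv_mem (mem (Function.update t l (t l * t j)) j))
        simpa [Function.update_of_ne hij.symm] using this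
      · have := mem (Function.update t i (t i * t j)) l
        rwa [Function.update_of_ne hl] at this
    · by_cases hl : l = i
      · subst hl
        simpa using mul_mem (mem t l) (mem t j)
      · rw [Function.update_of_ne hl]
        exact mem t l
  | swap i j hij => rw [EquivLike.range_comp]

lemma NielsenEquiv.closure_range_eq {n : ℕ} {t t' : Fin n → G} (h : NielsenEquiv t t') :
    closure (Set.range t) = closure (Set.range t') := by
  induction h with
  | refl => rfl
  | tail _ h ih => exact ih.trans h.closure_range_eq

lemma nielsenEquiv_mul {n : ℕ} (t : Fin n → G) {i j : Fin n} (hij : i ≠ j) :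
    NielsenEquiv t (Function.update t i (t i * t j)) :=
  .single (.mul t i j hij)

/-- Invert the entry `j`, multiply, and invert the entry `j` back. -/
lemma nielsenEquiv_mul_inv {n : ℕ} (t : Fin n → G) {i j : Fin n} (hij : i ≠ j) :
    NielsenEquiv t (Function.update t i (t i * (t j)⁻¹)) := by
  have h1 := NielsenMove.inv t j
  have h2 := NielsenMove.mul (Function.update t j (t j)⁻¹) i j hij
  have h3 := NielsenMove.inv (Function.update (Function.update t j (t j)⁻¹) i
    (Function.update t j (t j)⁻¹ i * Function.update t j (t j)⁻¹ j)) j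
  refine ((Relation.ReflTransGen.single h1).tail h2).tail ?_
  convert h3 using 1
  ext l
  by_cases hl : l = j
  · subst hl; simp [Function.update_of_ne hij.symm]
  · by_cases hl' : l = i
    · subst hl'; simp [Function.update_of_ne hij]
    · simp [Function.update_of_ne hl, Function.update_of_ne hl']

lemma append_update {X : Type*} {k m : ℕ} (f : Fin k → X) (Z : Fin m → X) (i : Fin k) (v : X) :
    Fin.append (Function.update f i v) Z =
      Function.update (Fin.append f Z) (Fin.castAdd m i) v := by
  ext l
  refine Fin.addCases (fun l => ?_) (fun l => ?_) l
  · by_cases h : l = i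
    · subst h; simp
    · have h' : Fin.castAdd m l ≠ Fin.castAdd m i := fun e => h (Fin.castAdd_injective _ _ e)
      simp [Function.update_of_ne h, Function.update_of_ne h']
  · have h' : Fin.natAdd k l ≠ Fin.castAdd m i := by
      intro e
      have := congrArg Fin.val e
      simp at this
      omega
    simp [Function.update_of_ne h']

lemma sum_update_lt {X : Type*} {k : ℕ} (φ : X → ℕ) (f : Fin k → X) (i : Fin k) (v : X)
    (h : φ v < φ (f i)) : ∑ l, φ (Function.update f i v l) < ∑ l, φ (f l) := by
  refine Finset.sum_lt_sum (fun l _ => ?_) ⟨i, Finset.mem_univ _, by simpa using h⟩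
  by_cases hl : l = i
  · subst hl; simpa using h.le
  · rw [Function.update_of_ne hl]

lemma sum_update_eq {X : Type*} {k : ℕ} (φ : X → ℕ) (f : Fin k → X) (i : Fin k) (v : X)
    (h : φ v = φ (f i)) : ∑ l, φ (Function.update f i v l) = ∑ l, φ (f l) := by
  refine Finset.sum_congr rfl (fun l _ => ?_)
  by_cases hl : l = i
  · subst hl; simpa using h
  · rw [Function.update_of_ne hl]

section Relative

variable {k m : ℕ} (f : Fin k → G) (Z : Fin m → G)

lemma nielsenEquiv_append_mul {i j : Fin k} (hij : i ≠ j) :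
    NielsenEquiv (Fin.append f Z) (Fin.append (Function.update f i (f i * f j)) Z) := by
  have h' : Fin.castAdd m i ≠ Fin.castAdd m j := fun e => hij (Fin.castAdd_injective _ _ e)
  simpa [append_update] using nielsenEquiv_mul (Fin.append f Z) h'

lemma nielsenEquiv_append_mul_inv {i j : Fin k} (hij : i ≠ j) :
    NielsenEquiv (Fin.append f Z) (Fin.append (Function.update f i (f i * (f j)⁻¹)) Z) := by
  have h' : Fin.castAdd m i ≠ Fin.castAdd m j := fun e => hij (Fin.castAdd_injective _ _ e)
  simpa [append_update] using nielsenEquiv_mul_inv (Fin.append f Z) h'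

lemma nielsenEquiv_append_mul_right (i : Fin k) (l : Fin m) :
    NielsenEquiv (Fin.append f Z) (Fin.append (Function.update f i (f i * Z l)) Z) := by
  have h' : Fin.castAdd m i ≠ Fin.natAdd k l := by
    intro e
    have := congrArg Fin.val e
    simp at this
    omega
  simpa [append_update] using nielsenEquiv_mul (Fin.append f Z) h'

end Relative

/-! ### Normal form and finiteness of the Nielsen classes -/

namespace Axis

variable (A : Axis G)

/-- The number of entries reversing the axis. -/
noncomputable def reflCount {k : ℕ} (f : Fin k → G) : ℕ := ∑ i, if A.ε (f i) = 1 then 0 else 1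

/-- The total displacement of a tuple. -/
noncomputable def displ {k : ℕ} (f : Fin k → G) : ℕ := ∑ i, (A.b (f i)).natAbs

/-- Every tuple is Nielsen equivalent, relative to a tuple on which `b` vanishes, to one that is
minimal. -/
lemma exists_minimal {k m : ℕ} (g : Fin k → G) (Z : Fin m → G) :
    ∃ f : Fin k → G, NielsenEquiv (Fin.append g Z) (Fin.append f Z) ∧
      ∀ i v, NielsenEquiv (Fin.append f Z) (Fin.append (Function.update f i v) Z) →
        (A.ε v = 1 → A.ε (f i) = 1) ∧
        (A.ε v = A.ε (f i) → (A.b (f i)).natAbs ≤ (A.b v).natAbs) := by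
  -- Lexicographic order: losing a reflection counts even if the displacements grow.
  have wf : WellFounded fun p q : ℕ ×ₗ ℕ => p < q := wellFounded_lt
  obtain ⟨f, hf, hmin⟩ := (InvImage.wf (fun f : Fin k → G => toLex (A.reflCount f, A.displ f))
    wf).has_min {f | NielsenEquiv (Fin.append g Z) (Fin.append f Z)} ⟨g, .refl⟩
  refine ⟨f, hf, fun i v hv => ?_⟩
  have key := hmin _ (Relation.ReflTransGen.trans hf hv)
  simp only [InvImage, Prod.Lex.toLex_lt_toLex, not_or, not_and] at key
  constructor
  · intro h1
    by_contra h2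
    exact key.1 (sum_update_lt (fun x => if A.ε x = 1 then 0 else 1) f i v (by simp [h1, h2]))
  · intro h1
    by_contra h2
    exact key.2 (sum_update_eq (fun x => if A.ε x = 1 then 0 else 1) f i v (by simp [h1]))
      (sum_update_lt (fun x => (A.b x).natAbs) f i v (by simpa using h2))

/-- Normal form of tuples up to Nielsen equivalence relative to a tuple generating a subgroup on
which `b` vanishes. -/
lemma exists_normalForm {k m : ℕ} (g : Fin k → G) (Z : Fin m → G) (hZ : ∀ l, A.b (Z l) = 0) :
    ∃ (f : Fin k → G) (x w : ℤ), NielsenEquiv (Fin.append g Z) (Fin.append f Z) ∧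
      closure (Set.range (Fin.append f Z)) ≤ (A.shift w).divSubgroup (2 * x) ∧
      (x = 0 ∨ (∀ i, |A.b (f i)| ≤ |x|) ∧ ∃ j, A.ε (f j) = 1 ∧ A.b (f j) = x) := by
  obtain ⟨f, hf, hmin⟩ := A.exists_minimal g Z
  have neg : ∀ g, A.ε g ≠ 1 → A.ε g = -1 := fun g => (Int.units_eq_one_or _).resolve_left
  -- an entry is not shortened by a translation
  have htr : ∀ i j, i ≠ j → A.ε (f j) = 1 → A.b (f j) = 0 ∨
      2 * (A.b (f i)).natAbs ≤ (A.b (f j)).natAbs := by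
    intro i j hij hj
    have h1 := (hmin i _ (nielsenEquiv_append_mul f Z hij)).2 (by rw [map_mul, hj, mul_one])
    have h2 := (hmin i _ (nielsenEquiv_append_mul_inv f Z hij)).2
      (by rw [map_mul, map_inv, hj, inv_one, mul_one])
    rw [A.b_mul] at h1 h2
    rw [A.b_inv, hj] at h2
    rcases Int.units_eq_one_or (A.ε (f i)) with h | h <;> rw [h] at h1 h2 <;> push_cast at h1 h2 <;>
      omega
  -- at most one reflection
  have hrefl : ∀ i j, A.ε (f i) ≠ 1 → A.ε (f j) ≠ 1 → i = j := by
    intro i j hi hj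
    by_contra hij
    exact hi ((hmin i _ (nielsenEquiv_append_mul f Z hij)).1
      (by rw [map_mul, neg _ hi, neg _ hj]; rfl))
  have hreflZ : ∀ i l, A.ε (f i) ≠ 1 → A.ε (Z l) = 1 := by
    intro i l hi
    by_contra hl
    exact hi ((hmin i _ (nielsenEquiv_append_mul_right f Z i l)).1
      (by rw [map_mul, neg _ hi, neg _ hl]; rfl))
  -- The displacement of the only reflecting entry, or `0`; the shift by `w` puts the origin at its
  -- fixed point. If `Z` contains a reflection, then `w = 0` and the origin stays.
  obtain ⟨w, hw⟩ : ∃ w : ℤ, (∀ i, A.ε (f i) ≠ 1 → A.b (f i) = w) ∧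
      (∀ l, A.ε (Z l) ≠ 1 → w = 0) := by
    by_cases h : ∃ i, A.ε (f i) ≠ 1
    · obtain ⟨i, hi⟩ := h
      exact ⟨A.b (f i), fun j hj => by rw [hrefl i j hi hj], fun l hl => (hl (hreflZ i l hi)).elim⟩
    · push Not at h
      exact ⟨0, fun i hi => (hi (h i)).elim, fun _ _ => rfl⟩
  obtain ⟨x, hx, hx'⟩ : ∃ x : ℤ, (∀ i, A.ε (f i) = 1 → A.b (f i) = 0 ∨ A.b (f i) = x) ∧
      (x = 0 ∨ ∃ j, A.ε (f j) = 1 ∧ A.b (f j) = x) := by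
    by_cases h : ∃ j, A.ε (f j) = 1 ∧ A.b (f j) ≠ 0
    · obtain ⟨j, hj, hj0⟩ := h
      -- For two translations of nonzero displacement, `htr` would make each at least twice as long
      -- as the other.
      refine ⟨A.b (f j), fun i hi => ?_, Or.inr ⟨j, hj, rfl⟩⟩
      by_cases hij : i = j
      · subst hij; exact Or.inr rfl
      · have h1 := htr i j hij hj
        have h2 := htr j i (Ne.symm hij) hi
        left; omega
    · push Not at h
      exact ⟨0, fun i hi => Or.inl (h i hi), Or.inl rfl⟩
  refine ⟨f, x, w, hf, ?_, ?_⟩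
  · rw [closure_le]
    rintro _ ⟨l, rfl⟩
    change 2 * x ∣ 2 * _ + (_ - 1) * w
    refine Fin.addCases (fun i => ?_) (fun l => ?_) l
    · rw [Fin.append_left]
      by_cases hi : A.ε (f i) = 1
      · rw [hi]
        rcases hx i hi with h | h <;> rw [h] <;> simp
      · rw [hw.1 i hi, neg _ hi]
        exact ⟨0, by push_cast; ring⟩
    · rw [Fin.append_right, hZ]
      by_cases hl : A.ε (Z l) = 1
      · rw [hl]; simp
      · rw [hw.2 l hl]; simp
  · by_cases hx0 : x = 0
    · exact Or.inl hx0
    obtain ⟨j, hj, hjx⟩ := hx'.resolve_left hx0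
    refine Or.inr ⟨fun i => ?_, j, hj, hjx⟩
    by_cases hi : A.ε (f i) = 1
    · rcases hx i hi with h | h <;> rw [h]
      simp
    · have hij : i ≠ j := fun e => hi (e ▸ hj)
      rcases htr i j hij hj with h | h
      · omega
      · rw [hjx] at h
        rw [← Int.natCast_natAbs, ← Int.natCast_natAbs]; omega

lemma dvd_of_mem_shift {x w : ℤ} (h : A.t ∈ (A.shift w).divSubgroup (2 * x)) : x ∣ A.b A.t := by
  rw [mem_divSubgroup] at h
  simp only [shift, A.ε_t] at h
  simpa [mul_dvd_mul_iff_left] using h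

end Axis

/-- The divisor `x` of `b t` from the normal form cannot be `0`, so all displacements are bounded by
`b t`. -/
theorem finite_nielsen_classes (hG : IsVirtuallyCyclic G) {m : ℕ} (Z : Fin m → G)
    (hZ : Finite (closure (Set.range Z))) (k : ℕ) :
    ∃ E : Set (Fin k → G), E.Finite ∧
      ∀ g : Fin k → G, closure (Set.range (Fin.append g Z)) = ⊤ →
        ∃ f ∈ E, NielsenEquiv (Fin.append g Z) (Fin.append f Z) := by
  cases finite_or_infinite G with
  | inl _ => exact ⟨Set.univ, Set.finite_univ, fun g _ => ⟨g, Set.mem_univ _, .refl⟩⟩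
  | inr _ =>
    obtain ⟨A₀⟩ := exists_axis hG
    obtain ⟨A, -, hA⟩ := A₀.exists_vanishing (closure (Set.range Z))
    refine ⟨{f | ∀ i, |A.b (f i)| ≤ A.b A.t}, ?_, fun g hg => ?_⟩
    · have := Set.Finite.pi fun _ : Fin k => A.finite_bounded (A.b A.t)
      exact this.subset fun f hf i _ => hf i
    · obtain ⟨f, x, w, hf, hdiv, hx⟩ := A.exists_normalForm g Z fun l => hA _ (subset_closure ⟨l, rfl⟩)
      have h1 : x ∣ A.b A.t := A.dvd_of_mem_shift (hdiv (by rw [← hf.closure_range_eq, hg]; trivial))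
      have hpos := A.b_pos
      refine ⟨f, fun i => ?_, hf⟩
      rcases hx with hx | ⟨hx, -⟩
      · rw [hx, zero_dvd_iff] at h1; omega
      · exact (hx i).trans (Int.le_of_dvd hpos ((abs_dvd _ _).2 h1))


/-! ### Detecting the relative rank in a finite quotient -/

namespace Axis

variable (A : Axis G)

lemma finiteIndex_zpowers {c : ℤ} (hc : c ≠ 0) : (zpowers (A.t ^ c)).FiniteIndex := by
  have := A.finiteIndex
  have : NeZero c.natAbs := ⟨by simpa using hc⟩
  have hs : Function.Surjective fun p : (G ⧸ zpowers A.t) × Fin c.natAbs =>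
      ((p.1.out * A.t ^ (p.2 : ℤ) : G) : G ⧸ zpowers (A.t ^ c)) := by
    intro q
    obtain ⟨g, rfl⟩ := QuotientGroup.mk_surjective q
    obtain ⟨a, ha⟩ : (g : G ⧸ zpowers A.t).out⁻¹ * g ∈ zpowers A.t :=
      QuotientGroup.eq.1 (QuotientGroup.out_eq' _)
    have hlt : (a % c).toNat < c.natAbs := by
      have := Int.emod_lt_abs a hc
      have := Int.emod_nonneg a hc
      rw [← Int.natCast_natAbs] at *
      omega
    refine ⟨(g, ⟨(a % c).toNat, hlt⟩), QuotientGroup.eq.2 ⟨a / c, ?_⟩⟩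
    simp only at ha ⊢
    rw [mul_inv_rev, mul_assoc, ← ha, Int.toNat_of_nonneg (Int.emod_nonneg a hc), ← zpow_neg,
      ← zpow_add, ← zpow_mul]
    congr 1
    have := Int.mul_ediv_add_emod a c
    omega
  have := Finite.of_surjective _ hs
  exact finiteIndex_of_finite_quotient

/-- An infinite subgroup has finite index. -/
lemma finiteIndex_of_infinite (A : Axis G) (H : Subgroup G) (hH : Infinite H) : H.FiniteIndex := by
  by_cases h : ∃ c : ℤ, c ≠ 0 ∧ A.t ^ c ∈ H
  · obtain ⟨c, hc, h⟩ := h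
    have := A.finiteIndex_zpowers hc
    exact finiteIndex_of_le ((zpowers_le).2 h)
  · push Not at h
    exfalso
    have := A.finiteIndex
    refine not_finite_iff_infinite.2 hH (Finite.of_injective
      (fun x : H => ((x : G) : G ⧸ zpowers A.t)) ?_)
    intro x y hxy
    obtain ⟨a, ha⟩ := QuotientGroup.eq.1 hxy
    simp only at ha
    have h0 : a = 0 := by
      by_contra h0
      exact h a h0 (ha ▸ mul_mem (inv_mem x.2) y.2)
    rw [h0, zpow_zero] at ha
    exact Subtype.ext (inv_mul_eq_one.1 ha.symm)

lemma exists_pow_index (y : G) : ∃ c : ℤ, A.t ^ c = y ^ (zpowers A.t).index := by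
  have : (zpowers A.t).Normal := by simpa using A.normal_zpowers 1
  exact pow_index_mem (zpowers A.t) y

/-- Let `d` be the index of `⟨t⟩`. In normal form only the translation `y = f j` needs a correction:
it is replaced by `y' = y ^ p * t ^ (2dq)`, whose displacement is the gcd of those of `y` and `t ^
(2d)`. Powers of `y'` recover `t ^ (2d)`, hence `y ^ p`, and then `y` because `p` is prime to `2d`.
-/
lemma exists_generating {r m : ℕ} (Z : Fin m → G) (hZ : ∀ l, A.b (Z l) = 0) (g : Fin r → G)
    (hg : closure (Set.range (Fin.append g Z)) ⊔
      zpowers (A.t ^ (2 * ((zpowers A.t).index : ℤ))) = ⊤) :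
    ∃ f : Fin r → G, closure (Set.range (Fin.append f Z)) = ⊤ := by
  set d : ℤ := ((zpowers A.t).index : ℤ) with hd
  have hd0 : 0 < d := by
    have := A.finiteIndex.index_ne_zero
    omega
  obtain ⟨f, x, w, hf, hdiv, hx⟩ := A.exists_normalForm g Z hZ
  rw [hf.closure_range_eq] at hg
  have hD := A.b_pos
  set D := A.b A.t with hDdef
  have hbez := Int.gcd_eq_gcd_ab x (D * (2 * d))
  set p := Int.gcdA x (D * (2 * d))
  set q := Int.gcdB x (D * (2 * d))
  set x₀ : ℤ := (Int.gcd x (D * (2 * d)) : ℤ) with hx₀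
  have hx₀0 : x₀ ≠ 0 := by
    have : D * (2 * d) ≠ 0 := by positivity
    rw [hx₀]
    simp [Int.gcd_eq_zero_iff, this]
  obtain ⟨u, hu⟩ : x₀ ∣ x := Int.gcd_dvd_left ..
  have hx₀Dn : x₀ ∣ D * (2 * d) := Int.gcd_dvd_right ..
  -- After the shift all generators, including `t ^ (2d)`, have displacement divisible by `2 * x₀`;
  -- hence so has `t`.
  obtain ⟨e, he⟩ : x₀ ∣ D := by
    apply A.dvd_of_mem_shift (w := w)
    have hle : closure (Set.range (Fin.append f Z)) ⊔ zpowers (A.t ^ (2 * d)) ≤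
        (A.shift w).divSubgroup (2 * x₀) := by
      rw [sup_le_iff, zpowers_le]
      refine ⟨fun y hy => dvd_trans (mul_dvd_mul_left 2 ⟨u, hu⟩) (hdiv hy), ?_⟩
      change 2 * x₀ ∣ 2 * A.b _ + (A.ε _ - 1) * w
      rw [A.b_zpow A.ε_t, map_zpow, A.ε_t, one_zpow]
      simp only [Units.val_one, sub_self, zero_mul, add_zero]
      refine mul_dvd_mul_left 2 ?_
      rwa [mul_comm]
    exact hle (by rw [hg]; trivial)
  have h1 : u * p + e * (2 * d) * q = 1 := by
    refine mul_left_cancel₀ hx₀0 ?_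
    calc x₀ * (u * p + e * (2 * d) * q) = (x₀ * u) * p + (x₀ * e) * (2 * d) * q := by ring
      _ = x₀ * 1 := by rw [← hu, ← he, mul_one, ← hbez]
  -- Here the factor 2 in the exponent is needed: with `u = 0` the Bézout relation would make 1
  -- even. So a translation to correct exists.
  have hx0 : x ≠ 0 := by
    intro h
    rw [h] at hu
    have hu0 : u = 0 := by simpa [hx₀0] using hu.symm
    rw [hu0] at h1
    have : (2 : ℤ) ∣ 1 := ⟨e * d * q, by linarith⟩
    omega
  obtain ⟨-, j, hj, hjx⟩ := hx.resolve_left hx0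
  have hcop : IsCoprime p (d * (2 * d)) := by
    have h2 : IsCoprime p (2 * d) := ⟨u, e * q, by linarith⟩
    exact IsCoprime.mul_right h2.of_mul_right_right h2
  obtain ⟨p', s, hps⟩ := hcop
  set y := f j with hy
  set y' := y ^ p * A.t ^ (2 * d * q) with hy'
  have hby : A.b y' = x₀ := by
    rw [hy', A.b_mul_zpow, A.b_zpow hj, map_zpow, hj, one_zpow, hjx]
    rw [← hDdef, hbez]
    push_cast
    ring
  have hεy : A.ε y' = 1 := by rw [hy', map_mul, map_zpow, map_zpow, hj, A.ε_t]; simp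
  refine ⟨Function.update f j y', ?_⟩
  set K := closure (Set.range (Fin.append (Function.update f j y') Z)) with hK
  have hmem : ∀ l, Fin.append (Function.update f j y') Z l ∈ K := fun l => subset_closure ⟨l, rfl⟩
  have hy'K : y' ∈ K := by simpa using hmem (Fin.castAdd m j)
  -- The power `y' ^ d` lies in `⟨t⟩`, and comparing displacements gives `y' ^ d = t ^ c` with `c *
  -- e = d`.
  have htK : A.t ^ (2 * d) ∈ K := by
    obtain ⟨c, hc⟩ := A.exists_pow_index y'
    have h2 : c * D = d * x₀ := by
      have := congrArg A.b hc
      rwa [A.b_zpow A.ε_t, A.b_pow hεy, hby] at this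
    have h3 : c * e = d := by
      refine mul_left_cancel₀ hx₀0 ?_
      rw [he] at h2; linarith
    have h4 : A.t ^ (2 * d) = (A.t ^ c) ^ (2 * e) := by
      rw [← zpow_mul]; congr 1; linarith
    rw [h4, hc]
    exact zpow_mem (pow_mem hy'K _) _
  have hyK : y ∈ K := by
    have h2 : y ^ p ∈ K := by
      have : y ^ p = y' * ((A.t ^ (2 * d)) ^ q)⁻¹ := by rw [hy', ← zpow_mul]; group
      rw [this]
      exact mul_mem hy'K (inv_mem (zpow_mem htK _))
    obtain ⟨c, hc⟩ := A.exists_pow_index y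
    rw [← zpow_natCast, ← hd] at hc
    -- Since `y ^ d` is a power of `t`, its `2d`-th power is a power of `t ^ (2d)`.
    have h3 : y ^ (d * (2 * d)) ∈ K := by
      rw [zpow_mul, ← hc, ← zpow_mul, mul_comm, zpow_mul]
      exact zpow_mem htK _
    have h4 : y = (y ^ p) ^ p' * (y ^ (d * (2 * d))) ^ s := by
      rw [← zpow_mul, ← zpow_mul, ← zpow_add, mul_comm p, mul_comm _ s, hps, zpow_one]
    rw [h4]
    exact mul_mem (zpow_mem h2 _) (zpow_mem h3 _)
  rw [eq_top_iff, ← hg, sup_le_iff, zpowers_le, closure_le]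
  refine ⟨?_, htK⟩
  rintro _ ⟨l, rfl⟩
  refine Fin.addCases (fun i => ?_) (fun l => ?_) l
  · by_cases hij : i = j
    · subst hij; simpa using hyK
    · have := hmem (Fin.castAdd m i)
      rw [Fin.append_left, Function.update_of_ne hij] at this
      simpa using this
  · simpa using hmem (Fin.natAdd r l)

end Axis

lemma range_append {X : Type*} {r m : ℕ} (f : Fin r → X) (Z : Fin m → X) :
    Set.range (Fin.append f Z) = Set.range f ∪ Set.range Z := by
  ext y
  constructor
  · rintro ⟨l, rfl⟩
    refine Fin.addCases (fun i => ?_) (fun l => ?_) l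
    · left; simp
    · right; simp
  · rintro (⟨i, rfl⟩ | ⟨i, rfl⟩)
    · exact ⟨Fin.castAdd m i, by simp⟩
    · exact ⟨Fin.natAdd r i, by simp⟩

/-- In a virtually cyclic group the relative rank is detected by a finite quotient. -/
theorem exists_normal_finiteIndex (hG : IsVirtuallyCyclic G) {r m : ℕ} (Z : Fin m → G)
    (h : ∀ f : Fin r → G, closure (Set.range f ∪ Set.range Z) ≠ ⊤) :
    ∃ N : Subgroup G, N.Normal ∧ N.FiniteIndex ∧
      ∀ f : Fin r → G, closure (Set.range f ∪ Set.range Z) ⊔ N ≠ ⊤ := by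
  cases finite_or_infinite G with
  | inl _ => exact ⟨⊥, inferInstance, inferInstance, by simpa using h⟩
  | inr _ =>
    obtain ⟨A₀⟩ := exists_axis hG
    cases finite_or_infinite (closure (Set.range Z)) with
    | inl _ =>
      obtain ⟨A, -, hA⟩ := A₀.exists_vanishing (closure (Set.range Z))
      have hd := A.finiteIndex.index_ne_zero
      refine ⟨zpowers (A.t ^ (2 * ((zpowers A.t).index : ℤ))), A.normal_zpowers _,
        A.finiteIndex_zpowers (by positivity), fun g hg => ?_⟩
      rw [← range_append] at hg
      obtain ⟨f, hf⟩ := A.exists_generating Z (fun l => hA _ (subset_closure ⟨l, rfl⟩)) g hg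
      exact h f (by rw [← range_append, hf])
    | inr hinf =>
      have := A₀.finiteIndex_of_infinite _ hinf
      refine ⟨(closure (Set.range Z)).normalCore, inferInstance, inferInstance, fun f hf => h f ?_⟩
      rwa [sup_eq_left.2] at hf
      exact (normalCore_le _).trans (closure_mono Set.subset_union_right)

/-! ### Primitive recursive predicates -/

section Primrec

variable {α β σ : Type*} [Primcodable α] [Primcodable β] [Primcodable σ]

lemma primrecPred_forall_mem {f : α → List β} {p : α → β → Prop} (hf : Primrec f)
    (hp : PrimrecPred fun q : α × β => p q.1 q.2) : PrimrecPred fun a => ∀ x ∈ f a, p a x :=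
  (PrimrecRel.forall_mem_list (R := fun x a => p a x)
    (hp.comp (Primrec.snd.pair Primrec.fst))).comp hf Primrec.id

lemma primrecPred_exists_mem {f : α → List β} {p : α → β → Prop} (hf : Primrec f)
    (hp : PrimrecPred fun q : α × β => p q.1 q.2) : PrimrecPred fun a => ∃ x ∈ f a, p a x :=
  (PrimrecRel.exists_mem_list (R := fun x a => p a x)
    (hp.comp (Primrec.snd.pair Primrec.fst))).comp hf Primrec.id

lemma primrecPred_forall_lt {f : α → ℕ} {p : α → ℕ → Prop} (hf : Primrec f)
    (hp : PrimrecPred fun q : α × ℕ => p q.1 q.2) : PrimrecPred fun a => ∀ x < f a, p a x :=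
  (primrecPred_forall_mem (Primrec.list_range.comp hf) hp).of_eq fun a => by simp

lemma primrecPred_exists_lt {f : α → ℕ} {p : α → ℕ → Prop} (hf : Primrec f)
    (hp : PrimrecPred fun q : α × ℕ => p q.1 q.2) : PrimrecPred fun a => ∃ x < f a, p a x :=
  (primrecPred_exists_mem (Primrec.list_range.comp hf) hp).of_eq fun a => by simp

lemma primrecPred_imp {p q : α → Prop} (hp : PrimrecPred p) (hq : PrimrecPred q) :
    PrimrecPred fun a => p a → q a :=
  (hp.not.or hq).of_eq fun _ => imp_iff_not_or.symm

lemma primrec_pow {f g : α → ℕ} (hf : Primrec f) (hg : Primrec g) :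
    Primrec fun a => f a ^ g a :=
  (Primrec₂.unpaired'.1 Nat.Primrec.pow).comp hf hg

lemma primrec_getD {f : α → List β} {g : α → ℕ} (d : β) (hf : Primrec f) (hg : Primrec g) :
    Primrec fun a => (f a).getD (g a) d :=
  (Primrec.list_getD d).comp hf hg

lemma primrec_append {f g : α → List β} (hf : Primrec f) (hg : Primrec g) :
    Primrec fun a => f a ++ g a :=
  Primrec.list_append.comp hf hg

lemma primrecPred_eq {f g : α → β} (hf : Primrec f) (hg : Primrec g) :
    PrimrecPred fun a => f a = g a :=
  Primrec.eq.comp hf hg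

lemma primrecPred_lt {f g : α → ℕ} (hf : Primrec f) (hg : Primrec g) :
    PrimrecPred fun a => f a < g a :=
  Primrec.nat_lt.comp hf hg

end Primrec

/-! ### Certificates and the search for them -/

/-- Words in countably many letters. -/
abbrev NWord : Type := List (ℕ × Bool)

section Words

variable {α : Type*} [Primcodable α]

lemma primrec_invRev {f : α → NWord} (hf : Primrec f) :
    Primrec fun a => FreeGroup.invRev (f a) := by
  refine Primrec.list_reverse.comp (Primrec.list_map hf ?_)
  exact ((Primrec.fst.comp .snd).pair (Primrec.not.comp (Primrec.snd.comp .snd))).to₂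

lemma primrec_reduce : Primrec (FreeGroup.reduce : NWord → NWord) := by
  have hstep : Primrec fun q : NWord × (ℕ × Bool) × NWord =>
      (List.casesOn q.2.2 [q.2.1] fun hd tl =>
        if q.2.1.1 = hd.1 ∧ q.2.1.2 = !hd.2 then tl else q.2.1 :: hd :: tl : NWord) := by
    refine Primrec.list_casesOn (f := fun q : NWord × (ℕ × Bool) × NWord => q.2.2)
      (g := fun q => ([q.2.1] : NWord)) (h := fun q p => if q.2.1.1 = p.1.1 ∧ q.2.1.2 = !p.1.2
        then p.2 else q.2.1 :: p.1 :: p.2) (Primrec.snd.comp .snd)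
      (Primrec.list_cons.comp (Primrec.fst.comp .snd) (Primrec.const [])) (Primrec₂.mk ?_)
    have hx : Primrec fun p : (NWord × (ℕ × Bool) × NWord) × (ℕ × Bool) × NWord => p.1.2.1 :=
      Primrec.fst.comp (Primrec.snd.comp .fst)
    have hhd : Primrec fun p : (NWord × (ℕ × Bool) × NWord) × (ℕ × Bool) × NWord => p.2.1 :=
      Primrec.fst.comp .snd
    have htl : Primrec fun p : (NWord × (ℕ × Bool) × NWord) × (ℕ × Bool) × NWord => p.2.2 :=
      Primrec.snd.comp .snd
    refine Primrec.ite ?_ htl (Primrec.list_cons.comp hx (Primrec.list_cons.comp hhd htl))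
    exact (primrecPred_eq (Primrec.fst.comp hx) (Primrec.fst.comp hhd)).and
      (primrecPred_eq (Primrec.snd.comp hx) (Primrec.not.comp (Primrec.snd.comp hhd)))
  refine (Primrec.list_foldr (f := fun L : NWord => L) (g := fun _ => ([] : NWord))
    Primrec.id (Primrec.const []) hstep.to₂).of_eq fun L => ?_
  induction L with
  | nil => rfl
  | cons a L ih => rw [List.foldr_cons, ih]; rfl

/-- A conjugate of a relator, or an element of `V`, or the inverse of such. -/
def conjTerm (R V : List NWord) (x : NWord × ℕ × Bool) : NWord :=
  (if x.2.1 < R.length then x.1 else []) ++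
    (if x.2.2 = true then (R ++ V).getD x.2.1 [] else FreeGroup.invRev ((R ++ V).getD x.2.1 [])) ++
    FreeGroup.invRev (if x.2.1 < R.length then x.1 else [])

lemma primrec_conjTerm {R V : α → List NWord} {x : α → NWord × ℕ × Bool} (hR : Primrec R)
    (hV : Primrec V) (hx : Primrec x) : Primrec fun a => conjTerm (R a) (V a) (x a) := by
  have hi : Primrec fun a => (x a).2.1 := Primrec.fst.comp (Primrec.snd.comp hx)
  have hc : Primrec fun a => if (x a).2.1 < (R a).length then (x a).1 else [] :=
    Primrec.ite (primrecPred_lt hi (Primrec.list_length.comp hR)) (Primrec.fst.comp hx)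
      (Primrec.const [])
  have hs := primrec_getD [] (primrec_append hR hV) hi
  exact primrec_append (primrec_append hc (Primrec.ite
    (primrecPred_eq (Primrec.snd.comp (Primrec.snd.comp hx)) (Primrec.const true))
    hs (primrec_invRev hs))) (primrec_invRev hc)

/-- The lists `D` show that the letters `0, …, n - 1` are products of conjugates of relators,
elements of `V` and their inverses. -/
def GeneratesCheck (n : ℕ) (R V : List NWord) (D : List (List (NWord × ℕ × Bool))) : Prop :=
  ∀ i < n, FreeGroup.reduce ((D.getD i []).flatMap (conjTerm R V)) = [(i, true)]

lemma primrecPred_generatesCheck {n : α → ℕ} {R V : α → List NWord}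
    {D : α → List (List (NWord × ℕ × Bool))} (hn : Primrec n) (hR : Primrec R)
    (hV : Primrec V) (hD : Primrec D) :
    PrimrecPred fun a => GeneratesCheck (n a) (R a) (V a) (D a) := by
  refine primrecPred_forall_lt hn (primrecPred_eq (primrec_reduce.comp (Primrec.list_flatMap
    (primrec_getD [] (hD.comp .fst) .snd) ?_))
    (Primrec.list_cons.comp (Primrec.snd.pair (Primrec.const true)) (Primrec.const [])))
  exact (primrec_conjTerm (hR.comp (Primrec.fst.comp .fst)) (hV.comp (Primrec.fst.comp .fst))
    .snd).to₂

/-- Multiplication according to a table. -/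
def tmul (T : List (List ℕ)) (a b : ℕ) : ℕ := (T.getD a []).getD b 0

/-- The value of a letter; `γ` lists the values of the letters and of their inverses. -/
def letterVal (γ : List (ℕ × ℕ)) (x : ℕ × Bool) : ℕ :=
  if x.2 = true then (γ.getD x.1 (0, 0)).1 else (γ.getD x.1 (0, 0)).2

/-- The value of a word. -/
def wordVal (T : List (List ℕ)) (γ : List (ℕ × ℕ)) (w : NWord) : ℕ :=
  w.foldl (fun a x => tmul T a (letterVal γ x)) 0

/-- Membership in a set of natural numbers given by its indicator. -/
def InSet (s : List Bool) (a : ℕ) : Prop := s.getD a false = true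

lemma primrec_tmul {T : α → List (List ℕ)} {f g : α → ℕ} (hT : Primrec T) (hf : Primrec f)
    (hg : Primrec g) : Primrec fun a => tmul (T a) (f a) (g a) :=
  primrec_getD 0 (primrec_getD [] hT hf) hg

lemma primrec_letterVal {γ : α → List (ℕ × ℕ)} {x : α → ℕ × Bool} (hγ : Primrec γ)
    (hx : Primrec x) : Primrec fun a => letterVal (γ a) (x a) := by
  have h := primrec_getD (0, 0) hγ (Primrec.fst.comp hx)
  exact Primrec.ite (primrecPred_eq (Primrec.snd.comp hx) (Primrec.const true))
    (Primrec.fst.comp h) (Primrec.snd.comp h)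

lemma primrec_wordVal {T : α → List (List ℕ)} {γ : α → List (ℕ × ℕ)} {w : α → NWord}
    (hT : Primrec T) (hγ : Primrec γ) (hw : Primrec w) :
    Primrec fun a => wordVal (T a) (γ a) (w a) := by
  refine Primrec.list_foldl (h := fun a q => tmul (T a) q.1 (letterVal (γ a) q.2)) hw
    (Primrec.const 0) ?_
  exact (primrec_tmul (hT.comp .fst) (Primrec.fst.comp .snd)
    (primrec_letterVal (hγ.comp .fst) (Primrec.snd.comp .snd))).to₂

lemma primrecPred_inSet {s : α → List Bool} {f : α → ℕ} (hs : Primrec s) (hf : Primrec f) :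
    PrimrecPred fun a => InSet (s a) (f a) :=
  primrecPred_eq (primrec_getD false hs hf) (Primrec.const true)

/-- `T` is the table of a monoid on `{0, …, N - 1}` with neutral element `0`. -/
def MonoidCheck (N : ℕ) (T : List (List ℕ)) : Prop :=
  0 < N ∧ ∀ a < N, tmul T 0 a = a ∧ tmul T a 0 = a ∧ ∀ b < N, tmul T a b < N ∧
    ∀ c < N, tmul T (tmul T a b) c = tmul T a (tmul T b c)

/-- The letters have values in the monoid, and the relators have trivial value. -/
def LetterCheck (n : ℕ) (R : List NWord) (N : ℕ) (T : List (List ℕ)) (γ : List (ℕ × ℕ)) : Prop :=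
  (∀ i < n, letterVal γ (i, true) < N ∧ letterVal γ (i, false) < N ∧
    tmul T (letterVal γ (i, true)) (letterVal γ (i, false)) = 0 ∧
    tmul T (letterVal γ (i, false)) (letterVal γ (i, true)) = 0) ∧
  ∀ w ∈ R, wordVal T γ w = 0

/-- For every `r`-tuple in the monoid there is a submonoid containing it and the values of the
words in `Z`, but not the value of every letter. -/
def TupleCheck (n : ℕ) (Z : List NWord) (N : ℕ) (T : List (List ℕ)) (γ : List (ℕ × ℕ)) (r : ℕ)
    (S : List (List Bool)) : Prop :=
  ∀ c < N ^ r, InSet (S.getD c []) 0 ∧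
    (∀ a < N, ∀ b < N, InSet (S.getD c []) a → InSet (S.getD c []) b →
      InSet (S.getD c []) (tmul T a b)) ∧
    -- The number `c` encodes an `r`-tuple by its base `N` digits.
    (∀ i < r, InSet (S.getD c []) (c / N ^ i % N)) ∧
    (∀ w ∈ Z, InSet (S.getD c []) (wordVal T γ w)) ∧
    ∃ i < n, ¬ InSet (S.getD c []) (letterVal γ (i, true))

lemma primrecPred_monoidCheck {N : α → ℕ} {T : α → List (List ℕ)} (hN : Primrec N)
    (hT : Primrec T) : PrimrecPred fun a => MonoidCheck (N a) (T a) := by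
  refine (primrecPred_lt (Primrec.const 0) hN).and (primrecPred_forall_lt hN ?_)
  have hN₁ := hN.comp (Primrec.fst : Primrec (Prod.fst : α × ℕ → α))
  have hT₁ := hT.comp (Primrec.fst : Primrec (Prod.fst : α × ℕ → α))
  refine (primrecPred_eq (primrec_tmul hT₁ (.const 0) .snd) .snd).and
    ((primrecPred_eq (primrec_tmul hT₁ .snd (.const 0)) .snd).and (primrecPred_forall_lt hN₁ ?_))
  have hN₂ := hN₁.comp (Primrec.fst : Primrec (Prod.fst : (α × ℕ) × ℕ → α × ℕ))
  have hT₂ := hT₁.comp (Primrec.fst : Primrec (Prod.fst : (α × ℕ) × ℕ → α × ℕ))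
  have hx := (Primrec.snd (α := α) (β := ℕ)).comp
    (Primrec.fst : Primrec (Prod.fst : (α × ℕ) × ℕ → α × ℕ))
  refine (primrecPred_lt (primrec_tmul hT₂ hx .snd) hN₂).and (primrecPred_forall_lt hN₂ ?_)
  have hT₃ := hT₂.comp (Primrec.fst : Primrec (Prod.fst : ((α × ℕ) × ℕ) × ℕ → (α × ℕ) × ℕ))
  have hx₃ := hx.comp (Primrec.fst : Primrec (Prod.fst : ((α × ℕ) × ℕ) × ℕ → (α × ℕ) × ℕ))
  have hy₃ := (Primrec.snd (α := α × ℕ) (β := ℕ)).comp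
    (Primrec.fst : Primrec (Prod.fst : ((α × ℕ) × ℕ) × ℕ → (α × ℕ) × ℕ))
  exact primrecPred_eq (primrec_tmul hT₃ (primrec_tmul hT₃ hx₃ hy₃) .snd)
    (primrec_tmul hT₃ hx₃ (primrec_tmul hT₃ hy₃ .snd))

lemma primrecPred_letterCheck {n N : α → ℕ} {R : α → List NWord} {T : α → List (List ℕ)}
    {γ : α → List (ℕ × ℕ)} (hn : Primrec n) (hR : Primrec R) (hN : Primrec N) (hT : Primrec T)
    (hγ : Primrec γ) : PrimrecPred fun a => LetterCheck (n a) (R a) (N a) (T a) (γ a) := by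
  refine (primrecPred_forall_lt hn ?_).and (primrecPred_forall_mem hR (primrecPred_eq
    (primrec_wordVal (hT.comp .fst) (hγ.comp .fst) .snd) (.const 0)))
  have hT₁ := hT.comp (Primrec.fst : Primrec (Prod.fst : α × ℕ → α))
  have h₁ : Primrec fun q : α × ℕ => letterVal (γ q.1) (q.2, true) :=
    primrec_letterVal (hγ.comp .fst) (Primrec.snd.pair (.const true))
  have h₀ : Primrec fun q : α × ℕ => letterVal (γ q.1) (q.2, false) :=
    primrec_letterVal (hγ.comp .fst) (Primrec.snd.pair (.const false))
  exact (primrecPred_lt h₁ (hN.comp .fst)).and ((primrecPred_lt h₀ (hN.comp .fst)).and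
    ((primrecPred_eq (primrec_tmul hT₁ h₁ h₀) (.const 0)).and
      (primrecPred_eq (primrec_tmul hT₁ h₀ h₁) (.const 0))))

lemma primrecPred_tupleCheck {n N r : α → ℕ} {Z : α → List NWord} {T : α → List (List ℕ)}
    {γ : α → List (ℕ × ℕ)} {S : α → List (List Bool)} (hn : Primrec n) (hZ : Primrec Z)
    (hN : Primrec N) (hT : Primrec T) (hγ : Primrec γ) (hr : Primrec r) (hS : Primrec S) :
    PrimrecPred fun a => TupleCheck (n a) (Z a) (N a) (T a) (γ a) (r a) (S a) := by
  refine primrecPred_forall_lt (primrec_pow hN hr) ?_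
  have f₁ : Primrec (Prod.fst : α × ℕ → α) := .fst
  have hs : Primrec fun q : α × ℕ => (S q.1).getD q.2 [] := primrec_getD [] (hS.comp f₁) .snd
  refine (primrecPred_inSet hs (.const 0)).and (PrimrecPred.and ?_ (PrimrecPred.and ?_
    (PrimrecPred.and ?_ ?_)))
  · refine primrecPred_forall_lt (hN.comp f₁) (primrecPred_forall_lt (hN.comp (f₁.comp .fst)) ?_)
    have f₃ : Primrec (fun q : ((α × ℕ) × ℕ) × ℕ => q.1.1) := Primrec.fst.comp .fst
    have ha : Primrec (fun q : ((α × ℕ) × ℕ) × ℕ => q.1.2) := Primrec.snd.comp .fst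
    exact primrecPred_imp (primrecPred_inSet (hs.comp f₃) ha)
      (primrecPred_imp (primrecPred_inSet (hs.comp f₃) .snd)
        (primrecPred_inSet (hs.comp f₃) (primrec_tmul (hT.comp (f₁.comp f₃)) ha .snd)))
  · refine primrecPred_forall_lt (hr.comp f₁) (primrecPred_inSet (hs.comp .fst) ?_)
    have hN₂ := hN.comp (f₁.comp (.fst : Primrec (Prod.fst : (α × ℕ) × ℕ → α × ℕ)))
    exact Primrec.nat_mod.comp (Primrec.nat_div.comp (Primrec.snd.comp .fst)
      (primrec_pow hN₂ .snd)) hN₂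
  · exact primrecPred_forall_mem (hZ.comp f₁) (primrecPred_inSet (hs.comp .fst)
      (primrec_wordVal (hT.comp (f₁.comp .fst)) (hγ.comp (f₁.comp .fst)) .snd))
  · exact primrecPred_exists_lt (hn.comp f₁) (primrecPred_inSet (hs.comp .fst)
      (primrec_letterVal (hγ.comp (f₁.comp .fst)) (Primrec.snd.pair (.const true)))).not

end Words

/-- Input of the algorithm. -/
abbrev Input : Type := ℕ × List NWord × List NWord

/-- Certificate for the value of the relative rank: a relative generating list, derivations of the
letters, and a finite monoid with sets showing that there are no shorter such lists. -/
abbrev Cert : Type :=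
  (List NWord × List (List (NWord × ℕ × Bool))) ×
    (ℕ × List (List ℕ) × List (ℕ × ℕ) × List (List Bool))

/-- The certificate `c` shows that the relative rank is the length of `c.1.1`. -/
def CertCheck (a : Input) (c : Cert) : Prop :=
  GeneratesCheck a.1 a.2.1 (c.1.1 ++ a.2.2) c.1.2 ∧
    (c.1.1.length = 0 ∨ MonoidCheck c.2.1 c.2.2.1 ∧
      LetterCheck a.1 a.2.1 c.2.1 c.2.2.1 c.2.2.2.1 ∧
      TupleCheck a.1 a.2.2 c.2.1 c.2.2.1 c.2.2.2.1 (c.1.1.length - 1) c.2.2.2.2)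

lemma primrecPred_certCheck : PrimrecPred fun q : Input × Cert => CertCheck q.1 q.2 := by
  have hn : Primrec fun q : Input × Cert => q.1.1 := Primrec.fst.comp .fst
  have hR : Primrec fun q : Input × Cert => q.1.2.1 := Primrec.fst.comp (Primrec.snd.comp .fst)
  have hZ : Primrec fun q : Input × Cert => q.1.2.2 := Primrec.snd.comp (Primrec.snd.comp .fst)
  have hW : Primrec fun q : Input × Cert => q.2.1.1 := Primrec.fst.comp (Primrec.fst.comp .snd)
  have hD : Primrec fun q : Input × Cert => q.2.1.2 := Primrec.snd.comp (Primrec.fst.comp .snd)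
  have h2 : Primrec fun q : Input × Cert => q.2.2 := Primrec.snd.comp .snd
  have hN : Primrec fun q : Input × Cert => q.2.2.1 := Primrec.fst.comp h2
  have hT : Primrec fun q : Input × Cert => q.2.2.2.1 := Primrec.fst.comp (Primrec.snd.comp h2)
  have h3 : Primrec fun q : Input × Cert => q.2.2.2.2 := Primrec.snd.comp (Primrec.snd.comp h2)
  have hγ : Primrec fun q : Input × Cert => q.2.2.2.2.1 := Primrec.fst.comp h3
  have hS : Primrec fun q : Input × Cert => q.2.2.2.2.2 := Primrec.snd.comp h3
  have hl := Primrec.list_length.comp hW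
  exact (primrecPred_generatesCheck hn hR (primrec_append hW hZ) hD).and
    ((primrecPred_eq hl (.const 0)).or ((primrecPred_monoidCheck hN hT).and
      ((primrecPred_letterCheck hn hR hN hT hγ).and
        (primrecPred_tupleCheck hn hZ hN hT hγ (Primrec.nat_sub.comp hl (.const 1)) hS))))

/-- The search for a certificate. -/
lemma exists_partrec_search : ∃ A : Input →. ℕ, Partrec A ∧
    (∀ a r, r ∈ A a → ∃ c, CertCheck a c ∧ r = c.1.1.length) ∧
    (∀ a, (∃ c, CertCheck a c) → (A a).Dom) := by
  obtain ⟨inst, hc⟩ := primrecPred_certCheck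
  have hp : PrimrecPred fun q : Input × Cert => CertCheck q.1 q.2 := ⟨inst, hc⟩
  let f : Input → ℕ → Option ℕ := fun a k => (Encodable.decode k : Option Cert).bind fun c =>
    @ite _ (CertCheck a c) (inst (a, c)) (some c.1.1.length) none
  have hf : Primrec₂ f := by
    refine Primrec.option_bind (Primrec.decode.comp .snd) ?_
    have hp' : PrimrecPred fun q : (Input × ℕ) × Cert => CertCheck q.1.1 q.2 :=
      hp.comp ((Primrec.fst.comp .fst).pair .snd)
    exact (@Primrec.ite _ _ _ _ (fun q : (Input × ℕ) × Cert => CertCheck q.1.1 q.2)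
      (fun q => inst (q.1.1, q.2)) _ _ hp' (Primrec.option_some.comp (Primrec.list_length.comp
        (Primrec.fst.comp (Primrec.fst.comp .snd)))) (Primrec.const none)).to₂
  refine ⟨_, Partrec.rfindOpt hf.to_comp, fun a r hr => ?_, fun a ⟨c, hca⟩ => ?_⟩
  · obtain ⟨k, hk⟩ := Nat.rfindOpt_spec hr
    obtain ⟨c, -, hk⟩ := Option.bind_eq_some_iff.1 hk
    split at hk
    · exact ⟨c, ‹_›, (Option.some.inj hk).symm⟩
    · cases hk
  · refine Nat.rfindOpt_dom.2 ⟨Encodable.encode c, c.1.1.length, ?_⟩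
    simp only [f, Encodable.encodek, Option.bind_some, Option.mem_def]
    exact if_pos hca

/-! ### Soundness of certificates -/

lemma relRank_le_iff {G : Type*} [Group G] (Z : Set G) (r : ℕ) :
    relRank Z ≤ r ↔ ∃ f : Fin r → G, closure (Set.range f ∪ Z) = ⊤ := by
  constructor
  · intro h
    have h1 : relRank Z < (r : ℕ∞) + 1 := h.trans_lt (by exact_mod_cast Nat.lt_succ_self r)
    obtain ⟨S, h2⟩ := iInf_lt_iff.1 h1
    obtain ⟨hS, h3⟩ := iInf_lt_iff.1 h2
    have h4 : S.encard ≤ r := Order.le_of_lt_add_one h3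
    have hfin : S.Finite := Set.finite_of_encard_le_coe h4
    have := hfin.fintype
    have h5 : Fintype.card S ≤ r := by
      have := Set.encard_eq_coe_toFinset_card S
      rw [this] at h4
      rw [← Set.toFinset_card]
      exact_mod_cast h4
    obtain ⟨ι⟩ : Nonempty (S ↪ Fin r) := Function.Embedding.nonempty_of_card_le (by simpa using h5)
    classical
    -- Positions not used by `S` are filled with `1`.
    refine ⟨fun i => if hi : ∃ s, ι s = i then (hi.choose : G) else 1, ?_⟩
    rw [eq_top_iff, ← (show closure (S ∪ Z) = ⊤ from hS)]
    refine closure_mono (Set.union_subset_union_left _ fun s hs => ⟨ι ⟨s, hs⟩, ?_⟩)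
    have hi : ∃ s', ι s' = ι ⟨s, hs⟩ := ⟨_, rfl⟩
    simp only [dif_pos hi]
    have := ι.injective hi.choose_spec
    rw [this]
  · rintro ⟨f, hf⟩
    refine (iInf₂_le (Set.range f) hf).trans ?_
    rw [← Set.image_univ]
    refine (Set.encard_image_le _ _).trans ?_
    simp

/-- Words with bounded letters as words in countably many letters. -/
def codeWord {n : ℕ} (w : Word n) : NWord := w.map fun a => ((a.1 : ℕ), a.2)

lemma mk_codeWord {n : ℕ} (w : Word n) :
    FreeGroup.mk (codeWord w) = FreeGroup.map Fin.val (FreeGroup.mk w) := rfl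

section Presented

variable {n : ℕ} (R : List (Word n))

/-- The homomorphism from the free group of countable rank that kills the superfluous letters. -/
noncomputable def natHom : FreeGroup ℕ →* FinPresGroup n R :=
  FreeGroup.lift fun i => if h : i < n then PresentedGroup.of ⟨i, h⟩ else 1

lemma natHom_codeWord (w : Word n) : natHom R (FreeGroup.mk (codeWord w)) = wordElt R w := by
  have : (natHom R).comp (FreeGroup.map Fin.val) = PresentedGroup.mk _ := by
    ext i
    simp [natHom, PresentedGroup.of]
  exact DFunLike.congr_fun this (FreeGroup.mk w)

lemma natHom_of (i : Fin n) : natHom R (FreeGroup.of (i : ℕ)) = PresentedGroup.of i := by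
  simp [natHom]

lemma wordElt_eq_one {w : Word n} (hw : w ∈ R) : wordElt R w = 1 :=
  PresentedGroup.one_of_mem ⟨w, hw, rfl⟩

lemma mem_codeWords {L : List (Word n)} {w : NWord} :
    w ∈ codeWords L ↔ ∃ v ∈ L, codeWord v = w := List.mem_map

lemma natHom_mk_append (u v : NWord) : natHom R (FreeGroup.mk (u ++ v)) =
    natHom R (FreeGroup.mk u) * natHom R (FreeGroup.mk v) := by
  rw [← FreeGroup.mul_mk, map_mul]

lemma natHom_mk_invRev (u : NWord) : natHom R (FreeGroup.mk (FreeGroup.invRev u)) =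
    (natHom R (FreeGroup.mk u))⁻¹ := by
  rw [← FreeGroup.inv_mk, map_inv]

/-- Relators die in the group whatever the conjugator, even if it uses superfluous letters. Indices
out of range give the empty word and are harmless. -/
lemma natHom_conjTerm_mem (V : List NWord) (x : NWord × ℕ × Bool) :
    natHom R (FreeGroup.mk (conjTerm (codeWords R) V x)) ∈
      closure ((fun v => natHom R (FreeGroup.mk v)) '' {v | v ∈ V}) := by
  set K := closure ((fun v => natHom R (FreeGroup.mk v)) '' {v | v ∈ V})
  rw [conjTerm, natHom_mk_append, natHom_mk_append, natHom_mk_invRev]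
  have hs : natHom R (FreeGroup.mk (if x.2.2 = true then (codeWords R ++ V).getD x.2.1 []
      else FreeGroup.invRev ((codeWords R ++ V).getD x.2.1 []))) =
      natHom R (FreeGroup.mk ((codeWords R ++ V).getD x.2.1 [])) ∨
      natHom R (FreeGroup.mk (if x.2.2 = true then (codeWords R ++ V).getD x.2.1 []
      else FreeGroup.invRev ((codeWords R ++ V).getD x.2.1 []))) =
      (natHom R (FreeGroup.mk ((codeWords R ++ V).getD x.2.1 [])))⁻¹ := by
    split
    · exact Or.inl rfl
    · exact Or.inr (natHom_mk_invRev R _)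
  by_cases h : x.2.1 < (codeWords R).length
  · have h1 : natHom R (FreeGroup.mk ((codeWords R ++ V).getD x.2.1 [])) = 1 := by
      rw [List.getD_append _ _ _ _ h, List.getD_eq_getElem _ _ h]
      obtain ⟨v, hv, hvw⟩ := mem_codeWords.1 (List.getElem_mem h)
      rw [← hvw, natHom_codeWord, wordElt_eq_one R hv]
    rw [h1, inv_one, or_self] at hs
    rw [hs, mul_one, mul_inv_cancel]
    exact one_mem _
  · simp only [if_neg h]
    have h1 : natHom R (FreeGroup.mk ((codeWords R ++ V).getD x.2.1 [])) ∈ K := by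
      rw [List.getD_append_right _ _ _ _ (not_lt.1 h)]
      by_cases h2 : x.2.1 - (codeWords R).length < V.length
      · rw [List.getD_eq_getElem _ _ h2]
        exact subset_closure ⟨_, List.getElem_mem h2, rfl⟩
      · rw [List.getD_eq_default _ _ (not_lt.1 h2), ← FreeGroup.one_eq_mk, map_one]
        exact one_mem _
    rw [← FreeGroup.one_eq_mk, map_one, one_mul, inv_one, mul_one]
    rcases hs with hs | hs <;> rw [hs]
    · exact h1
    · exact inv_mem h1

lemma wordSet_eq (Z : List (Word n)) :
    wordSet R Z = (fun v => natHom R (FreeGroup.mk v)) '' {v | v ∈ codeWords Z} := by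
  ext g
  constructor
  · rintro ⟨w, hw, rfl⟩
    exact ⟨codeWord w, mem_codeWords.2 ⟨w, hw, rfl⟩, natHom_codeWord R w⟩
  · rintro ⟨_, hv, rfl⟩
    obtain ⟨w, hw, rfl⟩ := mem_codeWords.1 hv
    exact ⟨w, hw, (natHom_codeWord R w).symm⟩

lemma closure_eq_top_of_generatesCheck {V : List NWord} {D : List (List (NWord × ℕ × Bool))}
    (h : GeneratesCheck n (codeWords R) V D) :
    closure ((fun v => natHom R (FreeGroup.mk v)) '' {v | v ∈ V}) = ⊤ := by
  rw [eq_top_iff, ← PresentedGroup.closure_range_of, closure_le]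
  rintro _ ⟨i, rfl⟩
  have h1 := h i i.2
  have h2 : (FreeGroup.of (i : ℕ)) =
      FreeGroup.mk ((D.getD i []).flatMap (conjTerm (codeWords R) V)) := by
    rw [← FreeGroup.reduce.self (L := List.flatMap _ _), h1]; rfl
  rw [SetLike.mem_coe, ← natHom_of, h2]
  induction D.getD i [] with
  | nil => rw [List.flatMap_nil, ← FreeGroup.one_eq_mk, map_one]; exact one_mem _
  | cons x L ih =>
    rw [List.flatMap_cons, natHom_mk_append]
    exact mul_mem (natHom_conjTerm_mem R V x) ih

lemma relRank_le_of_generatesCheck {W : List NWord} {Z : List (Word n)}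
    {D : List (List (NWord × ℕ × Bool))}
    (h : GeneratesCheck n (codeWords R) (W ++ codeWords Z) D) :
    relRank (wordSet R Z) ≤ W.length := by
  rw [relRank_le_iff]
  refine ⟨fun i => natHom R (FreeGroup.mk (W.get i)), ?_⟩
  rw [← closure_eq_top_of_generatesCheck R h, wordSet_eq]
  congr 1
  ext g
  constructor
  · rintro (⟨i, rfl⟩ | ⟨v, hv, rfl⟩)
    · exact ⟨_, List.mem_append_left _ (List.get_mem W i), rfl⟩
    · exact ⟨v, List.mem_append_right _ hv, rfl⟩
  · rintro ⟨v, hv, rfl⟩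
    rcases List.mem_append.1 hv with hv | hv
    · obtain ⟨i, rfl⟩ := List.mem_iff_get.1 hv
      exact Or.inl ⟨i, rfl⟩
    · exact Or.inr ⟨v, hv, rfl⟩

end Presented

/-- The elements of the monoid given by a table. -/
@[ext]
structure TableElt (N : ℕ) (T : List (List ℕ)) where
  val : ℕ
  lt : val < N

namespace TableElt

variable {N : ℕ} {T : List (List ℕ)}

instance : Finite (TableElt N T) :=
  Finite.of_injective (fun x => (⟨x.val, x.lt⟩ : Fin N)) fun x y h => by
    ext; simpa using h

/-- The monoid given by a table. -/
abbrev monoid (h : MonoidCheck N T) : Monoid (TableElt N T) where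
  mul x y := ⟨tmul T x.val y.val, (h.2 _ x.lt).2.2 _ y.lt |>.1⟩
  one := ⟨0, h.1⟩
  mul_assoc x y z := TableElt.ext (((h.2 _ x.lt).2.2 _ y.lt).2 _ z.lt)
  one_mul x := TableElt.ext (h.2 _ x.lt).1
  mul_one x := TableElt.ext (h.2 _ x.lt).2.1

end TableElt

/-- The letters map to units of the finite monoid and the relators to 1, so the group maps to the
unit group. The image of `f` is one of the listed tuples, and the submonoid chosen for it traps the
image of the subgroup but misses some letter. -/
lemma closure_ne_top_of_tupleCheck {n : ℕ} (R Z : List (Word n)) {N r : ℕ} {T : List (List ℕ)}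
    {γ : List (ℕ × ℕ)} {S : List (List Bool)} (hM : MonoidCheck N T)
    (hL : LetterCheck n (codeWords R) N T γ) (hT : TupleCheck n (codeWords Z) N T γ r S)
    (f : Fin r → FinPresGroup n R) : closure (Set.range f ∪ wordSet R Z) ≠ ⊤ := by
  let _ := TableElt.monoid hM
  have mul_val : ∀ x y : TableElt N T, (x * y).val = tmul T x.val y.val := fun _ _ => rfl
  have one_val : (1 : TableElt N T).val = 0 := rfl
  let u : Fin n → (TableElt N T)ˣ := fun i =>
    { val := ⟨letterVal γ (i, true), (hL.1 i i.2).1⟩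
      inv := ⟨letterVal γ (i, false), (hL.1 i i.2).2.1⟩
      val_inv := TableElt.ext (hL.1 i i.2).2.2.1
      inv_val := TableElt.ext (hL.1 i i.2).2.2.2 }
  have hfold : ∀ (w : Word n) (a : TableElt N T),
      (codeWord w).foldl (fun a x => tmul T a (letterVal γ x)) a.val =
        (a * (FreeGroup.lift u (FreeGroup.mk w) : (TableElt N T)ˣ)).val := by
    intro w
    induction w with
    | nil => intro a; rw [← FreeGroup.one_eq_mk, map_one, Units.val_one, mul_one]; rfl
    | cons x w ih =>
      intro a
      have hx : tmul T a.val (letterVal γ ((x.1 : ℕ), x.2)) =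
          (a * (FreeGroup.lift u (FreeGroup.mk [x]) : (TableElt N T)ˣ)).val := by
        obtain ⟨i, s⟩ := x
        cases s <;> simp [FreeGroup.lift_mk, mul_val] <;> rfl
      have h1 : FreeGroup.mk (x :: w) = FreeGroup.mk [x] * FreeGroup.mk w := by
        rw [FreeGroup.mul_mk]; rfl
      rw [h1, map_mul, Units.val_mul, ← mul_assoc, ← ih, ← hx]
      rfl
  have hval : ∀ w : Word n,
      wordVal T γ (codeWord w) = (FreeGroup.lift u (FreeGroup.mk w)).val.val := fun w => by
    have := hfold w 1
    rwa [one_mul] at this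
  have hrel : ∀ g ∈ FreeGroup.mk '' {w : Word n | w ∈ R}, FreeGroup.lift u g = 1 := by
    rintro _ ⟨w, hw, rfl⟩
    refine Units.ext (TableElt.ext ?_)
    rw [← hval, hL.2 _ (mem_codeWords.2 ⟨w, hw, rfl⟩)]
    rfl
  let Φ : FinPresGroup n R →* (TableElt N T)ˣ := PresentedGroup.toGroup hrel
  have hΦ : ∀ w, Φ (wordElt R w) = FreeGroup.lift u (FreeGroup.mk w) := fun w => rfl
  have hΦi : ∀ i, Φ (PresentedGroup.of i) = u i := fun i => PresentedGroup.toGroup.of hrel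
  let c := finFunctionFinEquiv fun i => (⟨(Φ (f i)).val.val, (Φ (f i)).val.lt⟩ : Fin N)
  have hc : ∀ i : Fin r, (c : ℕ) / N ^ (i : ℕ) % N = (Φ (f i)).val.val := by
    intro i
    have h1 := finFunctionFinEquiv.symm_apply_apply
      fun i => (⟨(Φ (f i)).val.val, (Φ (f i)).val.lt⟩ : Fin N)
    have h2 := congrArg Fin.val (congrFun h1 i)
    rwa [finFunctionFinEquiv_symm_apply_val] at h2
  obtain ⟨h0, hmul, htup, hZ, i, hi, hni⟩ := hT c c.2
  have hpow : ∀ (x : (TableElt N T)ˣ) (k : ℕ), InSet (S.getD c []) x.val.val →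
      InSet (S.getD c []) (x ^ k).val.val := by
    intro x k hx
    induction k with
    | zero => rw [pow_zero]; exact h0
    | succ k ih =>
      rw [pow_succ, Units.val_mul, mul_val]
      exact hmul _ (x ^ k).val.lt _ x.val.lt ih hx
  -- Closure under inverses needs no check: in a finite group the inverse is a natural power.
  let L : Subgroup (TableElt N T)ˣ :=
    { carrier := {x | InSet (S.getD c []) x.val.val}
      one_mem' := h0
      mul_mem' := fun {x y} hx hy => hmul _ x.val.lt _ y.val.lt hx hy
      inv_mem' := fun {x} hx => by
        obtain ⟨k, hk⟩ := mem_powers_iff_mem_zpowers.2 (inv_mem (mem_zpowers x))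
        change InSet _ (x⁻¹).val.val
        simp only at hk
        rw [← hk]
        exact hpow x k hx }
  intro htop
  have hle : closure (Set.range f ∪ wordSet R Z) ≤ L.comap Φ := by
    rw [closure_le]
    rintro _ (⟨i, rfl⟩ | ⟨w, hw, rfl⟩)
    · change InSet _ _
      rw [← hc]
      exact htup i i.2
    · change InSet _ _
      rw [hΦ, ← hval]
      exact hZ _ (mem_codeWords.2 ⟨w, hw, rfl⟩)
  have h1 : PresentedGroup.of ⟨i, hi⟩ ∈ L.comap Φ := hle (by rw [htop]; trivial)
  rw [mem_comap, hΦi] at h1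
  exact hni h1

lemma relRank_eq_of_certCheck {n : ℕ} (R Z : List (Word n)) {c : Cert}
    (h : CertCheck (n, codeWords R, codeWords Z) c) :
    (c.1.1.length : ℕ∞) = relRank (wordSet R Z) := by
  refine le_antisymm ?_ (relRank_le_of_generatesCheck R h.1)
  rcases h.2 with h0 | ⟨hM, hL, hT⟩
  · rw [h0]; simp
  · by_contra hlt
    push Not at hlt
    have hle : relRank (wordSet R Z) ≤ (c.1.1.length - 1 : ℕ) := by
      obtain ⟨k, hk⟩ := ENat.ne_top_iff_exists.1 hlt.ne_top
      rw [← hk] at hlt ⊢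
      have : k < c.1.1.length := by exact_mod_cast hlt
      exact_mod_cast (by omega : k ≤ c.1.1.length - 1)
    obtain ⟨f, hf⟩ := (relRank_le_iff _ _).1 hle
    exact closure_ne_top_of_tupleCheck R Z hM hL hT f hf

/-! ### Existence of certificates -/

section Derivations

variable (R V : List NWord)

lemma mk_conjTerm_not (x : NWord × ℕ × Bool) :
    FreeGroup.mk (conjTerm R V (x.1, x.2.1, !x.2.2)) = (FreeGroup.mk (conjTerm R V x))⁻¹ := by
  obtain ⟨c, k, s⟩ := x
  simp only [conjTerm, ← FreeGroup.mul_mk, ← FreeGroup.inv_mk]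
  cases s <;> simp [mul_assoc, -FreeGroup.mul_mk, -FreeGroup.inv_mk] <;>
    simp only [← FreeGroup.inv_mk, inv_inv]

/-- The elements of the free group represented by products of terms `conjTerm R V x`. -/
def derivSubgroup : Subgroup (FreeGroup ℕ) where
  carrier := {g | ∃ L : List (NWord × ℕ × Bool), FreeGroup.mk (L.flatMap (conjTerm R V)) = g}
  one_mem' := ⟨[], rfl⟩
  mul_mem' := by
    rintro _ _ ⟨L, rfl⟩ ⟨L', rfl⟩
    exact ⟨L ++ L', by rw [List.flatMap_append, FreeGroup.mul_mk]⟩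
  inv_mem' := by
    rintro _ ⟨L, rfl⟩
    refine ⟨(L.map fun x => (x.1, x.2.1, !x.2.2)).reverse, ?_⟩
    induction L with
    | nil => rfl
    | cons x L ih =>
      rw [List.map_cons, List.reverse_cons, List.flatMap_append, ← FreeGroup.mul_mk, ih,
        List.flatMap_singleton, mk_conjTerm_not, List.flatMap_cons, ← FreeGroup.mul_mk, mul_inv_rev]

lemma mk_conjTerm_mem (x : NWord × ℕ × Bool) :
    FreeGroup.mk (conjTerm R V x) ∈ derivSubgroup R V :=
  ⟨[x], by rw [List.flatMap_singleton]⟩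

lemma conj_mem_derivSubgroup {w : NWord} (hw : w ∈ R) (g : FreeGroup ℕ) :
    g * FreeGroup.mk w * g⁻¹ ∈ derivSubgroup R V := by
  obtain ⟨k, hk, rfl⟩ := List.mem_iff_getElem.1 hw
  have h := mk_conjTerm_mem R V (g.toWord, k, true)
  simp only [conjTerm, ← FreeGroup.mul_mk, ← FreeGroup.inv_mk, if_pos hk, if_true,
    FreeGroup.mk_toWord] at h
  rwa [List.getD_append _ _ _ _ hk, List.getD_eq_getElem _ _ hk] at h

lemma mk_mem_derivSubgroup {w : NWord} (hw : w ∈ V) : FreeGroup.mk w ∈ derivSubgroup R V := by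
  obtain ⟨k, hk, rfl⟩ := List.mem_iff_getElem.1 hw
  have h := mk_conjTerm_mem R V ([], R.length + k, true)
  simp only [conjTerm, ← FreeGroup.mul_mk, ← FreeGroup.inv_mk, if_true,
    if_neg (not_lt.2 (Nat.le_add_right R.length k)), ← FreeGroup.one_eq_mk, one_mul, inv_one,
    mul_one] at h
  rwa [List.getD_append_right _ _ _ _ (Nat.le_add_right _ _), Nat.add_sub_cancel_left,
    List.getD_eq_getElem _ _ hk] at h

end Derivations

/-- The derivable elements form a subgroup `M` containing all conjugates of relators, hence the
kernel of the presentation. As `M` also maps onto the group, it is the whole free group, so it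
contains the letters. -/
lemma exists_generatesCheck {n : ℕ} (R V : List (Word n))
    (h : closure (wordSet R V) = ⊤) :
    ∃ D, GeneratesCheck n (codeWords R) (codeWords V) D := by
  set M := (derivSubgroup (codeWords R) (codeWords V)).comap (FreeGroup.map Fin.val)
  have hker : (PresentedGroup.mk (FreeGroup.mk '' {w : Word n | w ∈ R})).ker ≤ M := by
    intro g hg
    have hg' : g ∈ normalClosure (FreeGroup.mk '' {w : Word n | w ∈ R}) :=
      PresentedGroup.mk_eq_one_iff.1 hg
    have hle : normalClosure (FreeGroup.mk '' {w : Word n | w ∈ R}) ≤ M := by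
      rw [normalClosure, closure_le]
      intro y hy
      obtain ⟨_, ⟨w, hw, rfl⟩, hc⟩ := Group.mem_conjugatesOfSet_iff.1 hy
      obtain ⟨c, rfl⟩ := isConj_iff.1 hc
      change FreeGroup.map Fin.val _ ∈ derivSubgroup _ _
      rw [map_mul, map_mul, map_inv, ← mk_codeWord]
      exact conj_mem_derivSubgroup _ _ (mem_codeWords.2 ⟨w, hw, rfl⟩) _
    exact hle hg'
  have hmap : M.map (PresentedGroup.mk (FreeGroup.mk '' {w : Word n | w ∈ R})) = ⊤ := by
    rw [eq_top_iff, ← h, closure_le]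
    rintro _ ⟨w, hw, rfl⟩
    exact ⟨FreeGroup.mk w, mk_mem_derivSubgroup _ _ (mem_codeWords.2 ⟨w, hw, rfl⟩), rfl⟩
  have htop : ∀ g, g ∈ M := by
    intro g
    obtain ⟨y, hy, hyg⟩ : PresentedGroup.mk (FreeGroup.mk '' {w : Word n | w ∈ R}) g ∈
        M.map (PresentedGroup.mk _) := by rw [hmap]; trivial
    have h1 : y⁻¹ * g ∈ M := hker (by rw [MonoidHom.mem_ker, map_mul, map_inv, hyg, inv_mul_cancel])
    simpa using mul_mem (show y ∈ M from hy) h1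
  have hex : ∀ i : Fin n, ∃ L : List (NWord × ℕ × Bool),
      FreeGroup.reduce (L.flatMap (conjTerm (codeWords R) (codeWords V))) = [((i : ℕ), true)] := by
    intro i
    obtain ⟨L, hL⟩ := htop (FreeGroup.of i)
    refine ⟨L, ?_⟩
    rw [FreeGroup.map.of] at hL
    rw [← FreeGroup.toWord_mk, hL, FreeGroup.toWord_of]
  choose L hL using hex
  refine ⟨List.ofFn L, fun i hi => ?_⟩
  have := hL ⟨i, hi⟩
  rw [List.getD_eq_getElem _ _ (by simpa using hi), List.getElem_ofFn]
  exact this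

lemma getD_map_range {X : Type*} (f : ℕ → X) (d : X) {a N : ℕ} (h : a < N) :
    ((List.range N).map f).getD a d = f a := by
  rw [List.getD_eq_getElem _ _ (by simpa using h)]
  simp

lemma exists_enumeration (Q : Type*) [Group Q] [Finite Q] :
    ∃ (N : ℕ) (e : Q → ℕ) (d : ℕ → Q), (∀ q, e q < N) ∧ (∀ q, d (e q) = q) ∧
      (∀ a < N, e (d a) = a) ∧ e 1 = 0 := by
  classical
  obtain ⟨N, ⟨e₀⟩⟩ := Finite.exists_equiv_fin Q
  have hN : 0 < N := (e₀ 1).pos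
  -- The swap gives the identity the number 0, as `MonoidCheck` demands.
  let e : Q ≃ Fin N := e₀.trans (Equiv.swap (e₀ 1) ⟨0, hN⟩)
  refine ⟨N, fun q => e q, fun a => if h : a < N then e.symm ⟨a, h⟩ else 1, fun q => (e q).2,
    fun q => by simp, fun a h => by simp [h], by simp [e]⟩

lemma exists_notMem_closure {n : ℕ} (R Z : List (Word n)) {r : ℕ} {Q : Type*} [Group Q]
    (q : FinPresGroup n R →* Q) (hq : Function.Surjective q)
    (h : ∀ f : Fin r → FinPresGroup n R, closure (Set.range f ∪ wordSet R Z) ⊔ q.ker ≠ ⊤)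
    (p : Fin r → Q) :
    ∃ i, q (PresentedGroup.of i) ∉ closure (Set.range p ∪ q '' wordSet R Z) := by
  by_contra hcon
  push Not at hcon
  choose f hf using fun i => hq (p i)
  refine h f ?_
  have hp : p = fun i => q (f i) := funext fun i => (hf i).symm
  have hmap : closure (Set.range p ∪ q '' wordSet R Z) =
      (closure (Set.range f ∪ wordSet R Z)).map q := by
    rw [MonoidHom.map_closure, Set.image_union, ← Set.range_comp, hp]
    rfl
  have htop : closure (Set.range p ∪ q '' wordSet R Z) = ⊤ := by
    rw [eq_top_iff, ← map_top_of_surjective q hq, ← PresentedGroup.closure_range_of,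
      MonoidHom.map_closure, closure_le]
    rintro _ ⟨_, ⟨i, rfl⟩, rfl⟩
    exact hcon i
  rw [← comap_map_eq, ← hmap, htop, comap_top]

/-- The table is that of the finite quotient `Q`, and the set for a tuple is the subgroup it
generates with the image of `Z`. This is proper by `exists_notMem_closure`, so some letter is
missing. -/
lemma exists_tupleCheck {n : ℕ} (R Z : List (Word n)) {r : ℕ} {Q : Type*} [Group Q]
    [Finite Q] (q : FinPresGroup n R →* Q) (hq : Function.Surjective q)
    (h : ∀ f : Fin r → FinPresGroup n R, closure (Set.range f ∪ wordSet R Z) ⊔ q.ker ≠ ⊤) :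
    ∃ k T γ S, MonoidCheck k T ∧ LetterCheck n (codeWords R) k T γ ∧
      TupleCheck n (codeWords Z) k T γ r S := by
  classical
  obtain ⟨k, e, d, he, hde, hed, he1⟩ := exists_enumeration Q
  let T : List (List ℕ) := (List.range k).map fun a => (List.range k).map fun b => e (d a * d b)
  let x : ℕ → FinPresGroup n R := fun i => if h : i < n then PresentedGroup.of ⟨i, h⟩ else 1
  let γ : List (ℕ × ℕ) := (List.range n).map fun i => (e (q (x i)), e (q (x i)⁻¹))
  let K : ℕ → Subgroup Q := fun c =>
    closure (Set.range (fun i : Fin r => d (c / k ^ (i : ℕ) % k)) ∪ q '' wordSet R Z)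
  let S : List (List Bool) := (List.range (k ^ r)).map fun c =>
    (List.range k).map fun a => decide (d a ∈ K c)
  have hk : 0 < k := (Nat.zero_le _).trans_lt (he 1)
  have hT : ∀ a < k, ∀ b < k, tmul T a b = e (d a * d b) := by
    intro a ha b hb
    rw [tmul, getD_map_range _ _ ha, getD_map_range _ _ hb]
  have hTe : ∀ a b, tmul T (e a) (e b) = e (a * b) := by
    intro a b
    rw [hT _ (he a) _ (he b), hde, hde]
  have hlt : ∀ i : Fin n, letterVal γ ((i : ℕ), true) = e (q (PresentedGroup.of i)) := by
    intro i
    simp only [letterVal, if_true, γ]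
    rw [getD_map_range _ _ i.2]
    simp [x]
  have hlf : ∀ i : Fin n, letterVal γ ((i : ℕ), false) = e (q (PresentedGroup.of i)⁻¹) := by
    intro i
    simp only [letterVal, γ]
    rw [getD_map_range _ _ i.2]
    simp [x]
  have hfold : ∀ (w : Word n) p, (codeWord w).foldl (fun a x => tmul T a (letterVal γ x)) (e p) =
      e (p * q (wordElt R w)) := by
    intro w
    induction w with
    | nil => intro p; simp [codeWord, wordElt, ← FreeGroup.one_eq_mk]
    | cons y w ih =>
      intro p
      have hy : letterVal γ ((y.1 : ℕ), y.2) = e (q (wordElt R [y])) := by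
        obtain ⟨i, s⟩ := y
        cases s
        · rw [hlf]; rfl
        · rw [hlt]; rfl
      have h1 : wordElt R (y :: w) = wordElt R [y] * wordElt R w := by
        rw [wordElt, wordElt, wordElt, ← map_mul, FreeGroup.mul_mk]; rfl
      rw [h1, map_mul, ← mul_assoc, ← ih, ← hTe, ← hy]
      rfl
  have hword : ∀ w : Word n, wordVal T γ (codeWord w) = e (q (wordElt R w)) := by
    intro w
    have := hfold w 1
    rwa [he1, one_mul] at this
  refine ⟨k, T, γ, S, ⟨hk, fun a ha => ⟨?_, ?_, fun b hb => ⟨?_, fun c hc => ?_⟩⟩⟩,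
    ⟨fun i hi => ⟨?_, ?_, ?_, ?_⟩, ?_⟩, fun c hc => ?_⟩
  · conv_lhs => rw [← he1, ← hed a ha]
    rw [hTe, one_mul, hed a ha]
  · conv_lhs => rw [← he1, ← hed a ha]
    rw [hTe, mul_one, hed a ha]
  · rw [hT a ha b hb]; exact he _
  · rw [← hed a ha, ← hed b hb, ← hed c hc]
    simp only [hTe, mul_assoc]
  · rw [hlt ⟨i, hi⟩]; exact he _
  · rw [hlf ⟨i, hi⟩]; exact he _
  · rw [hlf ⟨i, hi⟩, hlt ⟨i, hi⟩, hTe, ← map_mul, mul_inv_cancel, map_one, he1]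
  · rw [hlf ⟨i, hi⟩, hlt ⟨i, hi⟩, hTe, ← map_mul, inv_mul_cancel, map_one, he1]
  · intro w hw
    obtain ⟨v, hv, rfl⟩ := mem_codeWords.1 hw
    rw [hword, wordElt_eq_one R hv, map_one, he1]
  · have hS : ∀ p, InSet (S.getD c []) (e p) ↔ p ∈ K c := by
      intro p
      rw [InSet, getD_map_range _ _ hc, getD_map_range _ _ (he p), hde, decide_eq_true_iff]
    refine ⟨?_, fun a ha b hb hac hbc => ?_, fun i hi => ?_, fun w hw => ?_, ?_⟩
    · rw [← he1, hS]; exact one_mem _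
    · rw [← hed a ha, hS] at hac
      rw [← hed b hb, hS] at hbc
      rw [hT a ha b hb, hS]
      exact mul_mem hac hbc
    · rw [← hed _ (Nat.mod_lt _ hk), hS]
      exact subset_closure (Or.inl ⟨⟨i, hi⟩, rfl⟩)
    · obtain ⟨v, hv, rfl⟩ := mem_codeWords.1 hw
      rw [hword, hS]
      exact subset_closure (Or.inr ⟨_, ⟨v, hv, rfl⟩, rfl⟩)
    · obtain ⟨i, hi⟩ := exists_notMem_closure R Z q hq h fun i => d (c / k ^ (i : ℕ) % k)
      refine ⟨i, i.2, ?_⟩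
      rw [hlt, hS]
      exact hi

lemma exists_certCheck {n : ℕ} (R Z : List (Word n)) (hG : IsVirtuallyCyclic (FinPresGroup n R)) :
    ∃ c, CertCheck (n, codeWords R, codeWords Z) c := by
  have hfin : relRank (wordSet R Z) ≤ n := by
    rw [relRank_le_iff]
    refine ⟨PresentedGroup.of, ?_⟩
    rw [eq_top_iff, ← PresentedGroup.closure_range_of]
    exact closure_mono Set.subset_union_left
  obtain ⟨r, hr⟩ := ENat.ne_top_iff_exists.1 (ne_top_of_le_ne_top (ENat.natCast_ne_top n) hfin)
  obtain ⟨f, hf⟩ := (relRank_le_iff (wordSet R Z) r).1 hr.ge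
  have hsurj : ∀ g : FinPresGroup n R, ∃ w : Word n, wordElt R w = g := by
    intro g
    obtain ⟨y, rfl⟩ := PresentedGroup.mk_surjective _ g
    exact ⟨y.toWord, by rw [wordElt, FreeGroup.mk_toWord]⟩
  choose w hw using fun i => hsurj (f i)
  obtain ⟨D, hD⟩ := exists_generatesCheck R (List.ofFn w ++ Z) (by
    rw [eq_top_iff, ← hf, closure_le]
    rintro _ (⟨i, rfl⟩ | ⟨v, hv, rfl⟩)
    · exact subset_closure ⟨w i, List.mem_append_left _ (List.mem_ofFn.2 ⟨i, rfl⟩), hw i⟩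
    · exact subset_closure ⟨v, List.mem_append_right _ hv, rfl⟩)
  have happ : codeWords (List.ofFn w ++ Z) = codeWords (List.ofFn w) ++ codeWords Z :=
    List.map_append
  rw [happ] at hD
  have hlen : (codeWords (List.ofFn w)).length = r := by simp [codeWords]
  -- Rank 0 needs no lower bound; this also keeps `r - 1` from being truncated.
  rcases Nat.eq_zero_or_pos r with h0 | hpos
  · exact ⟨((codeWords (List.ofFn w), D), (0, [], [], [])), hD, Or.inl (hlen.trans h0)⟩
  · have hZ : wordSet R Z = Set.range fun l => wordElt R (Z.get l) := by
      ext g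
      constructor
      · rintro ⟨v, hv, rfl⟩
        obtain ⟨l, rfl⟩ := List.mem_iff_get.1 hv
        exact ⟨l, rfl⟩
      · rintro ⟨l, rfl⟩
        exact ⟨_, List.get_mem Z l, rfl⟩
    obtain ⟨N, hN, hNf, hNr⟩ := exists_normal_finiteIndex hG (r := r - 1)
      (fun l => wordElt R (Z.get l)) (by
        intro f' hf'
        rw [← hZ] at hf'
        have := (relRank_le_iff _ _).2 ⟨f', hf'⟩
        rw [← hr] at this
        have : r ≤ r - 1 := by exact_mod_cast this
        omega)
    rw [← hZ] at hNr
    obtain ⟨k, T, γ, S, h1, h2, h3⟩ := exists_tupleCheck R Z (QuotientGroup.mk' N)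
      (QuotientGroup.mk'_surjective N) (by rwa [QuotientGroup.ker_mk'])
    refine ⟨((codeWords (List.ofFn w), D), (k, T, γ, S)), hD, Or.inr ⟨h1, h2, ?_⟩⟩
    rw [hlen]
    exact h3

end VCRank


theorem mainTheorem7 :
    -- one algorithm computes the relative rank for all finite presentations of virtually cyclic
    -- groups and all finite subsets
    (∃ A : ℕ × List (List (ℕ × Bool)) × List (List (ℕ × Bool)) →. ℕ, Partrec A ∧
      ∀ (n : ℕ) (R Z : List (VCRank.Word n)),
        VCRank.IsVirtuallyCyclic (VCRank.FinPresGroup n R) →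
          ∃ r ∈ A (n, VCRank.codeWords R, VCRank.codeWords Z),
            (r : ℕ∞) = VCRank.relRank (VCRank.wordSet R Z)) ∧
    -- finiteness of the Nielsen classes of generating tuples `(g₁, …, gₖ, Z)`
    (∀ (G : Type*) [Group G], VCRank.IsVirtuallyCyclic G →
      ∀ (m : ℕ) (Z : Fin m → G), Finite (Subgroup.closure (Set.range Z)) →
        ∀ k : ℕ, 1 ≤ k →
          ∃ E : Set (Fin k → G), E.Finite ∧
            ∀ g : Fin k → G, Subgroup.closure (Set.range (Fin.append g Z)) = ⊤ →
              ∃ f ∈ E, VCRank.NielsenEquiv (Fin.append g Z) (Fin.append f Z)) := by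
  refine ⟨?_, fun G _ hG m Z hZ k _ => VCRank.finite_nielsen_classes hG Z hZ k⟩
  obtain ⟨A, hA, hsound, hdom⟩ := VCRank.exists_partrec_search
  refine ⟨A, hA, fun n R Z hG => ?_⟩
  have hd := hdom _ (VCRank.exists_certCheck R Z hG)
  obtain ⟨c, hc, hcr⟩ := hsound _ _ (Part.get_mem hd)
  exact ⟨_, Part.get_mem hd, by rw [hcr, VCRank.relRank_eq_of_certCheck R Z hc]⟩
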